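/- **Model.** A network is a finite directed graph $(\mathcal V,\mathcal E)$ with processing capacities $C_i>0$ $(i\in\mathcal V)$ and transmission capacities $C_{ij}>0$ $((i,j)\in\mathcal E)$, both per time slot. A placement $x=(x_{i,k})\in\{0,1\}^{\mathcal V\times\mathcal K}$ of finitely many databases is fixed, where $x_{i,k}=1$ means that database $k$ is cached at node $i$; it satisfies $\sum_k F_kx_{i,k}\le S_i$ for all $i$ ($F_k$ the size of database $k$, $S_i$ the storage capacity of node $i$). There are finitely many clients $c=(s,d,\phi)$ with source $s$, destination $d$ and service $\phi$. The service consists of $M-1\ge 0$ functions; function $m$ has scaling factor $\xi_m>0$ (live output packets per live input packet), workload $r_m\ge 0$ per live input packet, database $k_m$, and merging ratio $\zeta_m>0$ (static objects from database $k_m$ needed per live input packet). Put $\Xi_1=1$, $\Xi_{m+1}=\xi_m\Xi_m$. The augmented layered graph of $\phi$ has live nodes $i_m$ ($1\le m\le M$), static nodes $i'_m$ and super sources $o'_m$ ($1\le m\le M-1$), and edges $(i_m,j_m)$, $(i'_m,j'_m)$ for $(i,j)\in\mathcal E$, $(o'_m,i'_m)$ if $x_{i,k_m}=1$, and $(i_m,i_{m+1})$,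 $(i'_m,i_{m+1})$ for $i\in\mathcal V$. An efficient route $\sigma$ of client $c$ consists of processing nodes $\theta^{(1)},\dots,\theta^{(M-1)}$ (with $\theta^{(0)}=s$, $\theta^{(M)}=d$), the corresponding edges $(\theta^{(m)}_m,\theta^{(m)}_{m+1})$ and $(\theta'^{(m)}_m,\theta^{(m)}_{m+1})$, acyclic paths from $\theta^{(m-1)}_m$ to $\theta^{(m)}_m$ in the live pipelines ($1\le m\le M$), and acyclic paths from $o'_m$ to $\theta'^{(m)}_m$ in the static pipelines ($1\le m\le M-1$). The finite set of these routes is $\mathcal F_c(x)$. The loads of $\sigma$ are $$\rho_i^{(c,\sigma)}=\sum_m \Xi_m r_m\mathbf 1_{\{(i_m,i_{m+1})\in\sigma\}},\qquad \rho_{ij}^{(c,\sigma)}=\sum_m\bigl[\Xi_m\mathbf 1_{\{(i_m,j_m)\in\sigma\}}+\Xi_m\zeta_m\mathbf 1_{\{(i'_m,j'_m)\in\sigma\}}\bigr].$$ Requests (initial live packets) of client $c$ arrive in integer numbers $a^{(c)}(t)$, i.i.d. over the slots $t$ and bounded, with mean $\lambda^{(c)}$. An admissible policy is causal and possibly randomized,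 and must be able to handle every arrival sequence. For each request it selects upon arrival a flow in the augmented layered graph that injects one packet at $s_1$, delivers $\Xi_M$ packets at $d_M$, multiplies live flow by $\xi_m$ on $(i_m,i_{m+1})$, is otherwise conserved in the live and static pipelines, and satisfies $f_{i'_mi_{m+1}}=\zeta_m f_{i_mi_{m+1}}$; the static objects are replicated upon arrival. In every slot it schedules real-valued (divisible) amounts of the queued data, hop by hop along these flows, where live and static data of the same request are processed only in pairs (in ratio $1:\zeta_m$), and the resources used at node $i$ and at link $(i,j)$ are at most $C_i$ and $C_{ij}$. It stabilizes the queues if, almost surely, the total backlog of all processing, waiting and transmission queues at time $t$, divided by $t$, tends to $0$. The stability region $\Lambda(x)$ is the set of all arrival vectors $\lambda=(\lambda^{(c)})_c\ge 0$ such that, for every arrival process with rates $\lambda$, some admissible policy stabilizes the queues. **Theorem.** Let $\lambda\ge 0$ be an arrival vector. 1. $\lambda\in\Lambda(x)$ if and only if for each client $c$ there are probability values $\mathbb P_c(\sigma)\ge 0$, $\sum_{\sigma\in\mathcal F_c(x)}\mathbb P_c(\sigma)=1$, such that for each node $i$ and each link $(i,j)$ $$\sum_c\lambda^{(c)}\sum_{\sigma\in\mathcal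 F_c(x)}\rho_i^{(c,\sigma)}\mathbb P_c(\sigma)\le C_i,\qquad \sum_c\lambda^{(c)}\sum_{\sigma\in\mathcal F_c(x)}\rho_{ij}^{(c,\sigma)}\mathbb P_c(\sigma)\le C_{ij}.$$ 2. $\lambda$ is a topological interior point of $\Lambda(x)$, relative to the nonnegative orthant, if and only if there are such probability values for which all these inequalities are strict. 3. For any single arrival process with rates $\lambda$, some admissible policy stabilizes the queues if and only if $\lambda\in\Lambda(x)$. -/

import Mathlib

open MeasureTheory ProbabilityTheory Filter Topology
open scoped NNReal

noncomputable section

/-- A cache-enabled edge cloud: a directed graph of nodes and links, with processing capacities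
(instructions per slot), transmission capacities (data units per slot), storage capacities, and
the sizes of the databases. The number `linkCap i j` is only meaningful when `(i, j)` is a link. -/
structure EdgeCloud (V K : Type*) where
  graph : Digraph V
  nodeCap : V → ℝ
  linkCap : V → V → ℝ
  storage : V → ℝ
  dbSize : K → ℝ
  nodeCap_pos : ∀ i, 0 < nodeCap i
  linkCap_pos : ∀ i j, graph.Adj i j → 0 < linkCap i j

/-- A database placement: `x i k = true` means that database `k` is cached at node `i`. -/
abbrev Placement (V K : Type*) := V → K → Bool

/-- The set of placements that respect the storage capacities. -/
def EdgeCloud.placements {V K : Type*} [Fintype K] (G : EdgeCloud V K) : Set (Placement V K) :=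
  {x | ∀ i, ∑ k, (if x i k then G.dbSize k else 0) ≤ G.storage i}

/-- A data-intensive service with `n` functions, hence `n + 1` stages. Indices start at zero:
function `m : Fin n` turns packets of stage `m.castSucc` into packets of stage `m.succ`.
For one live input packet it needs `merge m` static objects of database `object m` and
`work m` units of computation, and it outputs `scale m` live packets. -/
structure Service (K : Type*) where
  n : ℕ
  scale : Fin n → ℝ
  work : Fin n → ℝ
  object : Fin n → K
  merge : Fin n → ℝ
  scale_pos : ∀ m, 0 < scale m
  work_nonneg : ∀ m, 0 ≤ work m
  merge_pos : ∀ m, 0 < merge m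

/-- Cumulative scaling factor: number of live packets of a given stage per packet of the
initial stage. -/
def Service.cumScale {K : Type*} (φ : Service K) : Fin (φ.n + 1) → ℝ :=
  Fin.induction 1 fun m prev => φ.scale m * prev

/-- A client: source node, destination node and requested service. -/
structure Client (V K : Type*) where
  src : V
  dst : V
  svc : Service K

/-- The possible edges of the augmented layered graph (ALG) of a service with `n` functions.
Its nodes are `i_m` (live pipeline of stage `m`), `i'_m` (static pipeline of function `m`) and
the super static sources `o'_m`. -/
inductive AlgEdge (V : Type*) (n : ℕ)
  /-- the edge `(i_m, j_m)` -/
  | live (m : Fin (n + 1)) (i j : V)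
  /-- the edge `(i'_m, j'_m)` -/
  | static (m : Fin n) (i j : V)
  /-- the edge `(o'_m, i'_m)` -/
  | replicate (m : Fin n) (i : V)
  /-- the edge `(i_m, i_{m+1})` -/
  | procLive (m : Fin n) (i : V)
  /-- the edge `(i'_m, i_{m+1})` -/
  | procStatic (m : Fin n) (i : V)

/-- The edges that are present in the ALG, given the network and the placement. -/
def algEdges {V K : Type*} (G : EdgeCloud V K) (x : Placement V K) (φ : Service K) :
    Set (AlgEdge V φ.n) :=
  {e | match e with
    | .live _ i j => G.graph.Adj i j
    | .static _ i j => G.graph.Adj i j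
    | .replicate m i => x i (φ.object m) = true
    | .procLive _ _ => True
    | .procStatic _ _ => True}

/-- Resource load of an ALG edge per request. (Replication consumes no resource.) -/
def Service.edgeLoad {V K : Type*} (φ : Service K) : AlgEdge V φ.n → ℝ
  | .live m _ _ => φ.cumScale m
  | .static m _ _ => φ.cumScale m.castSucc * φ.merge m
  | .replicate _ _ => 0
  | .procLive m _ => φ.cumScale m.castSucc * φ.work m
  | .procStatic _ _ => 0

/-! ### Efficient routes -/

/-- `l` is an acyclic path from `a` to `b` in the network (`[a]` if `a = b`). -/
def IsAcyclicPath {V : Type*} (g : Digraph V) (a b : V) (l : List V) : Prop :=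
  l.head? = some a ∧ l.getLast? = some b ∧ l.IsChain g.Adj ∧ l.Nodup

/-- The efficient routes of a client `c` under placement `x`: processing locations, an acyclic
path for the live packet of each stage, and an acyclic path for the static object of each
function, which starts at a node that caches the database. -/
structure EfficientRoute {V K : Type*} (G : EdgeCloud V K) (x : Placement V K)
    (c : Client V K) where
  loc : Fin c.svc.n → V
  livePath : Fin (c.svc.n + 1) → List V
  staticPath : Fin c.svc.n → List V
  live_spec : ∀ m, IsAcyclicPath G.graph
    (Fin.cons (α := fun _ => V) c.src loc m) (Fin.snoc (α := fun _ => V) loc c.dst m) (livePath m)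
  static_spec : ∀ m, ∃ v, x v (c.svc.object m) = true ∧
    IsAcyclicPath G.graph v (loc m) (staticPath m)

/-- The ALG edges that an efficient route contains. -/
def EfficientRoute.edges {V K : Type*} {G : EdgeCloud V K} {x : Placement V K} {c : Client V K}
    (σ : EfficientRoute G x c) : Set (AlgEdge V c.svc.n) :=
  {e | match e with
    | .live m i j => [i, j] <:+: σ.livePath m
    | .static m i j => [i, j] <:+: σ.staticPath m
    | .replicate m i => (σ.staticPath m).head? = some i
    | .procLive m i => σ.loc m = i
    | .procStatic m i => σ.loc m = i}

/-- There are finitely many efficient routes. -/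
instance EfficientRoute.instFinite {V K : Type*} [Finite V] {G : EdgeCloud V K}
    {x : Placement V K} {c : Client V K} : Finite (EfficientRoute G x c) := by
  have := Fintype.ofFinite V
  let T := {l : List V // l.Nodup}
  let f : EfficientRoute G x c →
      (Fin c.svc.n → V) × (Fin (c.svc.n + 1) → T) × (Fin c.svc.n → T) := fun σ =>
    (σ.loc, fun m => ⟨σ.livePath m, (σ.live_spec m).2.2.2⟩,
      fun m => ⟨σ.staticPath m, by obtain ⟨v, _, h⟩ := σ.static_spec m; exact h.2.2.2⟩)
  refine Finite.of_injective f ?_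
  rintro ⟨l₁, p₁, q₁, _, _⟩ ⟨l₂, p₂, q₂, _, _⟩ h
  simp only [f, Prod.mk.injEq, funext_iff, Subtype.mk.injEq] at h
  obtain ⟨h1, h2, h3⟩ := h
  obtain rfl := funext h1
  obtain rfl := funext h2
  obtain rfl := funext h3
  rfl

instance EfficientRoute.instFintype {V K : Type*} [Finite V] {G : EdgeCloud V K}
    {x : Placement V K} {c : Client V K} : Fintype (EfficientRoute G x c) :=
  Fintype.ofFinite _

/-- Processing load that a request delivered by `σ` imposes on node `i`. -/
def EfficientRoute.nodeLoad {V K : Type*} {G : EdgeCloud V K} {x : Placement V K}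
    {c : Client V K} (σ : EfficientRoute G x c) (i : V) : ℝ :=
  ∑ m, σ.edges.indicator c.svc.edgeLoad (.procLive m i)

/-- Transmission load that a request delivered by `σ` imposes on link `(i, j)`. -/
def EfficientRoute.linkLoad {V K : Type*} {G : EdgeCloud V K} {x : Placement V K}
    {c : Client V K} (σ : EfficientRoute G x c) (i j : V) : ℝ :=
  ∑ m, σ.edges.indicator c.svc.edgeLoad (.live m i j) +
    ∑ m, σ.edges.indicator c.svc.edgeLoad (.static m i j)

/-! ### Routing and scheduling decisions for one request -/

/-- Flow conservation in the ALG, at every node of every pipeline. Amounts `out e` leave a node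
along the edge `e`, amounts `inn e` have traversed the edge `e`; a live packet that traverses
`(i_m, i_{m+1})` becomes `scale m` packets, and a static object that traverses `(i'_m, i_{m+1})`
is used up. The amount `inj` enters at the source in the first stage, and the amount `del` is
delivered at the destination in the last stage. -/
structure Conserved {V K : Type*} [Fintype V] (c : Client V K)
    (out inn : AlgEdge V c.svc.n → ℝ) (inj del : ℝ) : Prop where
  live : ∀ (m : Fin (c.svc.n + 1)) (i : V),
    ∑ j, out (.live m i j) +
        Fin.lastCases (motive := fun _ => ℝ) (Set.indicator {c.dst} (fun _ => del) i)
          (fun m' => out (.procLive m' i)) m =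
      ∑ j, inn (.live m j i) +
        Fin.cases (motive := fun _ => ℝ) (Set.indicator {c.src} (fun _ => inj) i)
          (fun m' => c.svc.scale m' * inn (.procLive m' i)) m
  static : ∀ (m : Fin c.svc.n) (i : V),
    ∑ j, out (.static m i j) + out (.procStatic m i) =
      ∑ j, inn (.static m j i) + inn (.replicate m i)

/-- Data merging: the processed amounts of static objects and of live packets are in the
prescribed ratio. -/
def Merged {V K : Type*} (φ : Service K) (f : AlgEdge V φ.n → ℝ) : Prop :=
  ∀ m i, f (.procStatic m i) = φ.merge m * f (.procLive m i)

/-- An admissible route of one request of client `c`: a flow in the ALG that carries one initial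
live packet from the source to the destination, through all functions. -/
structure IsAdmissibleRoute {V K : Type*} [Fintype V] (G : EdgeCloud V K) (x : Placement V K)
    (c : Client V K) (f : AlgEdge V c.svc.n → ℝ) : Prop where
  nonneg : ∀ e, 0 ≤ f e
  support : ∀ e, e ∉ algEdges G x c.svc → f e = 0
  conserved : Conserved c f f 1 (c.svc.cumScale (Fin.last _))
  merged : Merged c.svc f

/-- What happens to one request: its route (chosen upon arrival), and the cumulative amounts, in
packets and up to the beginning of slot `t`, that have joined the queue of ALG edge `e`
(`joined t e`), that have been served by it (`crossed t e`) and that have been delivered. -/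
structure RequestRecord (V : Type*) (n : ℕ) where
  route : AlgEdge V n → ℝ
  joined : ℕ → AlgEdge V n → ℝ
  crossed : ℕ → AlgEdge V n → ℝ
  delivered : ℕ → ℝ

/-- The record `R` is a legal history of a request of client `c` that arrives in slot `τ`.
Upon arrival the live packet enters at the source and all static objects are replicated.
Data joins queues only along the route, and only data that is in the queue at the beginning of a
slot can be served in that slot. Live and static data of the request are processed in
pairs. -/
structure RequestRecord.IsLegal {V K : Type*} [Fintype V] (G : EdgeCloud V K)
    (x : Placement V K) (c : Client V K) (τ : ℕ) (R : RequestRecord V c.svc.n) : Prop where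
  route_admissible : IsAdmissibleRoute G x c R.route
  joined_mono : Monotone R.joined
  crossed_mono : Monotone R.crossed
  delivered_mono : Monotone R.delivered
  crossed_zero : R.crossed 0 = 0
  delivered_zero : R.delivered 0 = 0
  joined_le_route : ∀ t e, R.joined t e ≤ R.route e
  delivered_le : ∀ t, R.delivered t ≤ c.svc.cumScale (Fin.last _)
  replicated : ∀ t m i,
    R.crossed t (.replicate m i) = if τ < t then R.route (.replicate m i) else 0
  crossed_le_joined : ∀ t e, (∀ m i, e ≠ .replicate m i) → R.crossed (t + 1) e ≤ R.joined t e
  conserved : ∀ t, Conserved c (R.joined t) (R.crossed t) (if τ < t then 1 else 0) (R.delivered t)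
  merged : ∀ t, Merged c.svc (R.crossed t)

namespace RequestRecord

variable {V K : Type*} {n : ℕ}

/-- Amount of data in the queue of edge `e` at the beginning of slot `t`. -/
def queued (R : RequestRecord V n) (t : ℕ) (e : AlgEdge V n) : ℝ := R.joined t e - R.crossed t e

/-- Amount of data served by edge `e` in slot `t`. -/
def served (R : RequestRecord V n) (t : ℕ) (e : AlgEdge V n) : ℝ :=
  R.crossed (t + 1) e - R.crossed t e

/-- Contribution of the request to the transmission queue of link `(i, j)`. -/
def linkQueue (R : RequestRecord V n) (t : ℕ) (i j : V) : ℝ :=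
  ∑ m, R.queued t (.live m i j) + ∑ m, R.queued t (.static m i j)

/-- Amount of live data for function `m` at node `i` that is paired with static data. -/
def paired (φ : Service K) (R : RequestRecord V φ.n) (t : ℕ) (m : Fin φ.n) (i : V) : ℝ :=
  min (R.queued t (.procLive m i)) (R.queued t (.procStatic m i) / φ.merge m)

/-- Contribution of the request to the processing queue of node `i`: the paired live and static
data. -/
def procQueue (φ : Service K) (R : RequestRecord V φ.n) (t : ℕ) (i : V) : ℝ :=
  ∑ m, (R.paired φ t m i + φ.merge m * R.paired φ t m i)

/-- Contribution of the request to the waiting queue of node `i`: the unpaired live and static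
data. -/
def waitQueue (φ : Service K) (R : RequestRecord V φ.n) (t : ℕ) (i : V) : ℝ :=
  ∑ m, ((R.queued t (.procLive m i) - R.paired φ t m i) +
    (R.queued t (.procStatic m i) - φ.merge m * R.paired φ t m i))

/-- Computation spent at node `i` on the request in slot `t`. -/
def nodeUse (φ : Service K) (R : RequestRecord V φ.n) (t : ℕ) (i : V) : ℝ :=
  ∑ m, φ.work m * R.served t (.procLive m i)

/-- Transmission over link `(i, j)` for the request in slot `t`. -/
def linkUse (R : RequestRecord V n) (t : ℕ) (i j : V) : ℝ :=
  ∑ m, R.served t (.live m i j) + ∑ m, R.served t (.static m i j)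

end RequestRecord

/-! ### Policies and the stability region -/

/-- The records of all requests: `D c τ k` belongs to the `k`-th request that client `c` raises
in slot `τ`. -/
abbrev Records {V K C : Type*} (cl : C → Client V K) :=
  (c : C) → ℕ → ℕ → RequestRecord V (cl c).svc.n

/-- The sum of a quantity over all requests that have arrived before slot `t`, when client `c`
raises `α τ c` requests in slot `τ`. -/
def requestSum {C : Type*} [Fintype C] (α : ℕ → C → ℕ) (t : ℕ) (g : C → ℕ → ℕ → ℝ) : ℝ :=
  ∑ c, ∑ τ ∈ Finset.range t, ∑ k ∈ Finset.range (α τ c), g c τ k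

/-- Admissible decisions for the arrival sequence `α`: every request has a legal history, and the
resources used in a slot do not exceed the capacities. -/
structure IsAdmissible {V K C : Type*} [Fintype V] [Fintype C] (G : EdgeCloud V K)
    (cl : C → Client V K) (x : Placement V K) (α : ℕ → C → ℕ) (D : Records cl) : Prop where
  legal : ∀ c τ k, k < α τ c → (D c τ k).IsLegal G x (cl c) τ
  node_capacity : ∀ t i,
    requestSum α t (fun c τ k => (D c τ k).nodeUse (cl c).svc t i) ≤ G.nodeCap i
  link_capacity : ∀ t i j, G.graph.Adj i j →
    requestSum α t (fun c τ k => (D c τ k).linkUse t i j) ≤ G.linkCap i j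

open Classical in
/-- Total backlog of all processing, waiting and transmission queues at time `t`. -/
def totalBacklog {V K C : Type*} [Fintype V] [Fintype C] (G : EdgeCloud V K)
    (cl : C → Client V K) (α : ℕ → C → ℕ) (D : Records cl) (t : ℕ) : ℝ :=
  ∑ i, (requestSum α t (fun c τ k => (D c τ k).procQueue (cl c).svc t i) +
      requestSum α t (fun c τ k => (D c τ k).waitQueue (cl c).svc t i)) +
    ∑ i, ∑ j, if G.graph.Adj i j then requestSum α t (fun c τ k => (D c τ k).linkQueue t i j)
      else 0

/-- An admissible policy (possibly randomized, with a uniform random seed): a rule that turns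
arrival sequences into admissible decisions, where the decisions at a time depend only
on the seed and on the arrivals seen so far. -/
structure Policy {V K C : Type*} [Fintype V] [Fintype C] (G : EdgeCloud V K)
    (cl : C → Client V K) (x : Placement V K) where
  run : unitInterval → (ℕ → C → ℕ) → Records cl
  admissible : ∀ u α, IsAdmissible G cl x α (run u α)
  causal_route : ∀ u α β t, (∀ τ ≤ t, α τ = β τ) → ∀ c k, k < α t c →
    (run u α c t k).route = (run u β c t k).route
  causal_schedule : ∀ u α β t, (∀ τ < t, α τ = β τ) → ∀ c, ∀ τ < t, ∀ k < α τ c,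
    (run u α c τ k).joined t = (run u β c τ k).joined t ∧
    (run u α c τ k).crossed t = (run u β c τ k).crossed t ∧
    (run u α c τ k).delivered t = (run u β c τ k).delivered t
  measurable_route : ∀ α c τ k e, Measurable fun u => (run u α c τ k).route e
  measurable_joined : ∀ α c τ k t e, Measurable fun u => (run u α c τ k).joined t e
  measurable_crossed : ∀ α c τ k t e, Measurable fun u => (run u α c τ k).crossed t e
  measurable_delivered : ∀ α c τ k t, Measurable fun u => (run u α c τ k).delivered t

/-- `a t ω c` is the number of requests of client `c` that arrive in slot `t`. For each client the
arrivals are i.i.d. over time and bounded, with mean `rate c`. -/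
structure IsArrivalProcess {Ω C : Type*} [MeasurableSpace Ω] (P : Measure Ω)
    (a : ℕ → Ω → C → ℕ) (rate : C → ℝ≥0) : Prop where
  measurable : ∀ t c, Measurable fun ω => a t ω c
  indep : ∀ c, iIndepFun (fun t ω => a t ω c) P
  identDistrib : ∀ t c, IdentDistrib (fun ω => a t ω c) (fun ω => a 0 ω c) P P
  bounded : ∀ c, ∃ A : ℕ, ∀ t, ∀ᵐ ω ∂P, a t ω c ≤ A
  mean : ∀ c, ∫ ω, (a 0 ω c : ℝ) ∂P = rate c

/-- Some admissible policy keeps the actual queues (rate) stable under the arrival process `a`: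
almost surely, the total backlog divided by time tends to zero. -/
def IsStabilizable {V K C Ω : Type*} [Fintype V] [Fintype C] [MeasurableSpace Ω]
    (G : EdgeCloud V K) (cl : C → Client V K) (x : Placement V K) (P : Measure Ω)
    (a : ℕ → Ω → C → ℕ) : Prop :=
  ∃ π : Policy G cl x, ∀ᵐ p ∂(P.prod (volume : Measure unitInterval)),
    Tendsto (fun t : ℕ => (1 / (t : ℝ)) *
      totalBacklog G cl (fun τ => a τ p.1) (π.run p.2 (fun τ => a τ p.1)) t) atTop (𝓝 0)

/-- The network stability region under placement `x`: the arrival vectors that can be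
supported, i.e., arrivals of these rates are stabilized by an admissible policy. -/
def stabilityRegion {V K C : Type*} [Fintype V] [Fintype C] (G : EdgeCloud V K)
    (cl : C → Client V K) (x : Placement V K) : Set (C → ℝ≥0) :=
  {rate | ∀ (Ω : Type) [MeasurableSpace Ω] (P : Measure Ω) [IsProbabilityMeasure P]
    (a : ℕ → Ω → C → ℕ), IsArrivalProcess P a rate → IsStabilizable G cl x P a}

/-- A choice, for every client, of probability values on its efficient routes. -/
def IsRouteDistribution {V K C : Type*} [Fintype V] {G : EdgeCloud V K}
    {cl : C → Client V K} {x : Placement V K}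
    (prob : (c : C) → EfficientRoute G x (cl c) → ℝ) : Prop :=
  ∀ c, (∑ σ, prob c σ = 1) ∧ ∀ σ, 0 ≤ prob c σ

/-- Expected processing load at node `i`. -/
def expNodeLoad {V K C : Type*} [Fintype V] [Fintype C] {G : EdgeCloud V K}
    {cl : C → Client V K} {x : Placement V K} (rate : C → ℝ≥0)
    (prob : (c : C) → EfficientRoute G x (cl c) → ℝ) (i : V) : ℝ :=
  ∑ c, (rate c : ℝ) * ∑ σ, σ.nodeLoad i * prob c σ

/-- Expected transmission load at link `(i, j)`. -/
def expLinkLoad {V K C : Type*} [Fintype V] [Fintype C] {G : EdgeCloud V K}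
    {cl : C → Client V K} {x : Placement V K} (rate : C → ℝ≥0)
    (prob : (c : C) → EfficientRoute G x (cl c) → ℝ) (i j : V) : ℝ :=
  ∑ c, (rate c : ℝ) * ∑ σ, σ.linkLoad i j * prob c σ

end

/-! Sufficiency rests on pacing. Every request of client `c` is split among the efficient routes in
the given proportions, requests are released in order of arrival, at most `rate c` per slot, and
released data makes one hop per slot. In each slot every resource then carries at most its expected
load (`clientSum_served_pacedRecord_le`), so the non-strict inequalities already make these
decisions admissible for every arrival sequence. Each queue is bounded, up to a factor, by the
arrivals minus the amount released `d` slots earlier, where `d` bounds the number of hops. By the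
strong law this difference is o(t) (`tendsto_release`, `tendsto_queued_pacedRecord`). Stability only
asks for a backlog of o(t), which is why the boundary of the region belongs to it.

For necessity, fix one sample point at which the backlog is o(t) and the arrivals have the right
averages. The amounts that have crossed the edges, divided by t, are eventually bounded and converge
along an ultrafilter. What has joined a queue and what has left it differ by backlog only, so the
limit is a conserved, merged flow that injects `rate c` and respects the capacities
(`IsAdmissible.exists_flow`). Such a flow dominates a combination of efficient routes of total
weight `rate c` (`exists_decomposition`): if a combination of maximal weight fell short, the
residual would again be a flow, and following positive residual flow would give one more route to
add (`exists_route_of_flow`). Normalizing the weights gives the probabilities; a client of rate zero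
gets its routes from an admissible route chosen by the policy.

For interior points, the loads are linear in the arrival vector and the capacities are positive:
room to scale the vector up forces strict inequalities, and strict inequalities persist nearby for
the same probabilities. Since necessity looks at a single process, the region does not depend on the
process. -/

noncomputable section

/-! ### Paths as lists -/

open Classical in
-- Without repetitions, a member of the list either is its last element or has exactly one
-- successor. Together with the mirror image for predecessors this is flow conservation along a
-- path.
lemma List.Nodup.sum_isInfix_pair_add_getLast {V : Type*} [Fintype V] {l : List V} (hl : l.Nodup)
    (i : V) :
    ∑ j, (if [i, j] <:+: l then (1 : ℝ) else 0) + (if l.getLast? = some i then 1 else 0) =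
      if i ∈ l then 1 else 0 := by
  induction l with
  | nil => simp
  | cons a l ih =>
    cases l with
    | nil =>
      have : ∀ j, ¬ [i, j] <:+: [a] := fun j h => by simpa using h.length_le
      simp [this, eq_comm]
    | cons b l =>
      have ih := ih hl.of_cons
      have hinf : ∀ j, [i, j] <:+: a :: b :: l ↔ (i = a ∧ j = b) ∨ [i, j] <:+: b :: l := by
        intro j
        rw [List.infix_cons_iff]
        simp [List.cons_prefix_cons]
      have hlast : (a :: b :: l).getLast? = (b :: l).getLast? := by simp
      simp only [hinf, hlast]
      by_cases hia : i = a
      · have hn : i ∉ b :: l := hia ▸ (List.nodup_cons.1 hl).1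
        have h1 : ∀ j, ¬ [i, j] <:+: b :: l := fun j h => hn (h.subset (by simp))
        have h2 : (b :: l).getLast? ≠ some i := fun h => hn (List.mem_of_getLast? h)
        have h3 : i ∈ a :: b :: l := by simp [hia]
        have h4 : ∀ j, (i = a ∧ j = b) ∨ [i, j] <:+: b :: l ↔ j = b := fun j => by
          rw [or_iff_left (h1 j)]; simp [hia]
        rw [if_neg h2, if_pos h3]
        simp [h4]
      · have h3 : i ∈ a :: b :: l ↔ i ∈ b :: l := by simp [hia]
        simp only [hia, false_and, false_or, h3]
        exact ih

open Classical in
lemma List.Nodup.sum_isInfix_pair_add_head {V : Type*} [Fintype V] {l : List V} (hl : l.Nodup)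
    (i : V) :
    ∑ j, (if [j, i] <:+: l then (1 : ℝ) else 0) + (if l.head? = some i then 1 else 0) =
      if i ∈ l then 1 else 0 := by
  have h := (List.nodup_reverse.2 hl).sum_isInfix_pair_add_getLast i
  have hinf : ∀ j, [i, j] <:+: l.reverse ↔ [j, i] <:+: l := fun j => by
    rw [← List.reverse_infix]; simp
  simpa [hinf] using h

open Classical in
lemma List.Nodup.idxOf_of_isInfix_pair {V : Type*} {l : List V} (hl : l.Nodup) {j i : V}
    (h : [j, i] <:+: l) : l.idxOf i = l.idxOf j + 1 := by
  obtain ⟨s, t, rfl⟩ := h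
  have hl' : (s ++ (j :: i :: t)).Nodup := by simpa using hl
  have hj : j ∉ s := fun h => (List.disjoint_of_nodup_append hl') h (by simp)
  have hi : i ∉ s := fun h => (List.disjoint_of_nodup_append hl') h (by simp)
  have hji : j ≠ i := by
    have := (List.nodup_append.1 hl').2.1
    simp only [List.nodup_cons, List.mem_cons, not_or] at this
    exact this.1.1
  have he : s ++ [j, i] ++ t = s ++ (j :: i :: t) := by simp
  rw [he, List.idxOf_append_of_notMem hj, List.idxOf_append_of_notMem hi]
  simp [List.idxOf_cons_ne _ hji]

lemma exists_acyclicPath_of_reflTransGen {V : Type*} {r : V → V → Prop} {a b : V}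
    (h : Relation.ReflTransGen r a b) :
    ∃ l : List V, l.head? = some a ∧ l.getLast? = some b ∧ l.IsChain r ∧ l.Nodup := by
  induction h using Relation.ReflTransGen.head_induction_on with
  | refl => exact ⟨[b], by simp⟩
  | @head a c hac _ ih =>
    obtain ⟨l, h1, h2, h3, h4⟩ := ih
    -- A return to `a` is a loop: dropping everything before that occurrence keeps the path acyclic.
    by_cases ha : a ∈ l
    · obtain ⟨s, t, rfl⟩ := List.append_of_mem ha
      refine ⟨a :: t, rfl, ?_, (List.isChain_append.1 h3).2.1, (List.nodup_append.1 h4).2.1⟩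
      simpa [List.getLast?_append] using h2
    · cases l with
      | nil => simp at h1
      | cons d l =>
        obtain rfl : d = c := by simpa using h1
        exact ⟨a :: d :: l, rfl, by simpa using h2, List.IsChain.cons_cons hac h3,
          List.nodup_cons.2 ⟨ha, h4⟩⟩

lemma List.IsChain.rel_of_isInfix_pair {V : Type*} {r : V → V → Prop} {l : List V}
    (h : l.IsChain r) {i j : V} (hij : [i, j] <:+: l) : r i j := by
  simpa using h.infix hij

/-! ### Linearity of flow conservation -/

section Conserved

variable {V K : Type*} [Fintype V] {c : Client V K}

lemma Conserved.smul {out inn : AlgEdge V c.svc.n → ℝ} {inj del : ℝ}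
    (h : Conserved c out inn inj del) (r : ℝ) :
    Conserved c (fun e => r * out e) (fun e => r * inn e) (r * inj) (r * del) := by
  constructor
  · intro m i
    have := congrArg (r * ·) (h.live m i)
    simp only [mul_add, Finset.mul_sum] at this
    convert this using 2
    · refine Fin.lastCases ?_ (fun m' => ?_) m
      · by_cases hi : i = c.dst <;> simp [hi]
      · simp
    · refine Fin.cases ?_ (fun m' => ?_) m
      · by_cases hi : i = c.src <;> simp [hi]
      · simp; ring
  · intro m i
    have := congrArg (r * ·) (h.static m i)
    simpa only [mul_add, Finset.mul_sum] using this

lemma Conserved.sum {ι : Type*} {s : Finset ι} {out inn : ι → AlgEdge V c.svc.n → ℝ}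
    {inj del : ι → ℝ} (h : ∀ k ∈ s, Conserved c (out k) (inn k) (inj k) (del k)) :
    Conserved c (fun e => ∑ k ∈ s, out k e) (fun e => ∑ k ∈ s, inn k e) (∑ k ∈ s, inj k)
      (∑ k ∈ s, del k) := by
  constructor
  · intro m i
    have := Finset.sum_congr rfl fun k hk => (h k hk).live m i
    simp only [Finset.sum_add_distrib] at this
    rw [Finset.sum_comm, Finset.sum_comm (s := s)] at this
    convert this using 2
    · refine Fin.lastCases ?_ (fun m' => ?_) m
      · by_cases hi : i = c.dst <;> simp [hi]
      · simp
    · refine Fin.cases ?_ (fun m' => ?_) m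
      · by_cases hi : i = c.src <;> simp [hi]
      · simp [Finset.mul_sum]
  · intro m i
    have := Finset.sum_congr rfl fun k hk => (h k hk).static m i
    simp only [Finset.sum_add_distrib] at this
    rw [Finset.sum_comm, Finset.sum_comm (s := s)] at this
    exact this

lemma Conserved.sub {out inn out' inn' : AlgEdge V c.svc.n → ℝ} {inj del inj' del' : ℝ}
    (h : Conserved c out inn inj del) (h' : Conserved c out' inn' inj' del') :
    Conserved c (fun e => out e - out' e) (fun e => inn e - inn' e) (inj - inj') (del - del') := by
  -- A difference is a sum over `Bool` in which one term is scaled by -1.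
  have := Conserved.sum (c := c) (s := Finset.univ)
    (out := fun b : Bool => bif b then out else fun e => -1 * out' e)
    (inn := fun b : Bool => bif b then inn else fun e => -1 * inn' e)
    (inj := fun b : Bool => bif b then inj else -1 * inj')
    (del := fun b : Bool => bif b then del else -1 * del')
    (by rintro (_ | _) -
        · exact h'.smul (-1)
        · exact h)
  simpa [sub_eq_add_neg] using this

/-- Conservation passes to limits; the outgoing amounts of replication edges play no role. -/
lemma Conserved.of_tendsto {ι : Type*} {l : Filter ι} [l.NeBot]
    {out inn : ι → AlgEdge V c.svc.n → ℝ} {inj del : ι → ℝ} {f : AlgEdge V c.svc.n → ℝ} {a b : ℝ}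
    (h : ∀ k, Conserved c (out k) (inn k) (inj k) (del k))
    (hout : ∀ e, (∀ m i, e ≠ .replicate m i) → Tendsto (fun k => out k e) l (𝓝 (f e)))
    (hinn : ∀ e, Tendsto (fun k => inn k e) l (𝓝 (f e)))
    (hinj : Tendsto inj l (𝓝 a)) (hdel : Tendsto del l (𝓝 b)) :
    Conserved c f f a b := by
  constructor
  · intro m i
    refine tendsto_nhds_unique_of_eventuallyEq (f := fun k => _) (g := fun k => _) (l := l)
      (Tendsto.add (tendsto_finsetSum _ fun j _ => hout _ (by simp)) ?_)
      (Tendsto.add (tendsto_finsetSum _ fun j _ => hinn _) ?_)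
      (Eventually.of_forall fun k => (h k).live m i)
    · refine Fin.lastCases ?_ (fun m' => ?_) m
      · by_cases hi : i = c.dst <;> simp [hi, hdel]
      · simpa using hout _ (by simp)
    · refine Fin.cases ?_ (fun m' => ?_) m
      · by_cases hi : i = c.src <;> simp [hi, hinj]
      · simpa using (hinn _).const_mul _
  · intro m i
    exact tendsto_nhds_unique_of_eventuallyEq (f := fun k => _) (g := fun k => _) (l := l)
      (Tendsto.add (tendsto_finsetSum _ fun j _ => hout _ (by simp)) (hout _ (by simp)))
      (Tendsto.add (tendsto_finsetSum _ fun j _ => hinn _) (hinn _))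
      (Eventually.of_forall fun k => (h k).static m i)

end Conserved

/-! ### The flow of an efficient route -/

lemma Service.cumScale_zero {K : Type*} (φ : Service K) : φ.cumScale 0 = 1 := rfl

lemma Service.cumScale_succ {K : Type*} (φ : Service K) (m : Fin φ.n) :
    φ.cumScale m.succ = φ.scale m * φ.cumScale m.castSucc := rfl

lemma Service.cumScale_pos {K : Type*} (φ : Service K) (m : Fin (φ.n + 1)) :
    0 < φ.cumScale m := by
  induction m using Fin.induction with
  | zero => simp [Service.cumScale_zero]
  | succ m ih => rw [Service.cumScale_succ]; exact mul_pos (φ.scale_pos m) ih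

/-- Number of packets or objects that cross an edge of the route of one request. -/
def Service.packets {K V : Type*} (φ : Service K) : AlgEdge V φ.n → ℝ
  | .live m _ _ => φ.cumScale m
  | .static m _ _ => φ.cumScale m.castSucc * φ.merge m
  | .replicate m _ => φ.cumScale m.castSucc * φ.merge m
  | .procLive m _ => φ.cumScale m.castSucc
  | .procStatic m _ => φ.cumScale m.castSucc * φ.merge m

lemma Service.packets_nonneg {K V : Type*} (φ : Service K) (e : AlgEdge V φ.n) :
    0 ≤ φ.packets e := by
  have h1 := fun m => (φ.cumScale_pos m).le
  have h2 := fun m => (φ.merge_pos m).le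
  cases e <;> simp only [Service.packets] <;> first | exact h1 _ | exact mul_nonneg (h1 _) (h2 _)

namespace EfficientRoute

variable {V K : Type*} {G : EdgeCloud V K} {x : Placement V K} {c : Client V K}

/-- The flow of one request along an efficient route. -/
def flow (σ : EfficientRoute G x c) : AlgEdge V c.svc.n → ℝ := σ.edges.indicator c.svc.packets

variable (σ : EfficientRoute G x c)

lemma flow_nonneg (e : AlgEdge V c.svc.n) : 0 ≤ σ.flow e :=
  Set.indicator_nonneg (fun _ _ => c.svc.packets_nonneg _) _

lemma flow_eq_zero {e : AlgEdge V c.svc.n} (h : e ∉ σ.edges) : σ.flow e = 0 :=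
  Set.indicator_of_notMem h _

lemma flow_eq_mul_ite {e : AlgEdge V c.svc.n} {p : Prop} [Decidable p] (h : e ∈ σ.edges ↔ p) :
    σ.flow e = c.svc.packets e * if p then 1 else 0 := by
  split_ifs with hp
  · rw [flow, Set.indicator_of_mem (h.2 hp), mul_one]
  · rw [σ.flow_eq_zero fun he => hp (h.1 he), mul_zero]

open Classical in
lemma flow_live (m : Fin (c.svc.n + 1)) (i j : V) :
    σ.flow (.live m i j) = c.svc.cumScale m * if [i, j] <:+: σ.livePath m then 1 else 0 := by
  exact σ.flow_eq_mul_ite (p := [i, j] <:+: σ.livePath m) Iff.rfl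

open Classical in
lemma flow_static (m : Fin c.svc.n) (i j : V) :
    σ.flow (.static m i j) = c.svc.cumScale m.castSucc * c.svc.merge m *
      if [i, j] <:+: σ.staticPath m then 1 else 0 := by
  exact σ.flow_eq_mul_ite (p := [i, j] <:+: σ.staticPath m) Iff.rfl

open Classical in
lemma flow_replicate (m : Fin c.svc.n) (i : V) :
    σ.flow (.replicate m i) = c.svc.cumScale m.castSucc * c.svc.merge m *
      if (σ.staticPath m).head? = some i then 1 else 0 := by
  exact σ.flow_eq_mul_ite (p := (σ.staticPath m).head? = some i) Iff.rfl

open Classical in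
lemma flow_procLive (m : Fin c.svc.n) (i : V) :
    σ.flow (.procLive m i) = c.svc.cumScale m.castSucc * if σ.loc m = i then 1 else 0 := by
  exact σ.flow_eq_mul_ite (p := σ.loc m = i) Iff.rfl

open Classical in
lemma flow_procStatic (m : Fin c.svc.n) (i : V) :
    σ.flow (.procStatic m i) = c.svc.cumScale m.castSucc * c.svc.merge m *
      if σ.loc m = i then 1 else 0 := by
  exact σ.flow_eq_mul_ite (p := σ.loc m = i) Iff.rfl

lemma edges_subset : σ.edges ⊆ algEdges G x c.svc := by
  rintro (⟨m, i, j⟩ | ⟨m, i, j⟩ | ⟨m, i⟩ | ⟨m, i⟩ | ⟨m, i⟩) h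
  · exact (σ.live_spec m).2.2.1.rel_of_isInfix_pair h
  · obtain ⟨v, -, hv⟩ := σ.static_spec m
    exact hv.2.2.1.rel_of_isInfix_pair h
  · obtain ⟨v, hx, hv⟩ := σ.static_spec m
    have h' : (σ.staticPath m).head? = some i := h
    obtain rfl : v = i := by simpa [hv.1] using h'
    exact hx
  · trivial
  · trivial

lemma flow_eq_zero_of_notMem_algEdges {e : AlgEdge V c.svc.n} (he : e ∉ algEdges G x c.svc) :
    σ.flow e = 0 :=
  σ.flow_eq_zero fun h => he (σ.edges_subset h)

lemma nodeLoad_eq (i : V) : σ.nodeLoad i = ∑ m, c.svc.work m * σ.flow (.procLive m i) := by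
  classical
  refine Finset.sum_congr rfl fun m _ => ?_
  simp only [flow, Set.indicator_apply, Service.edgeLoad, Service.packets]
  split_ifs <;> ring

lemma linkLoad_eq (i j : V) :
    σ.linkLoad i j = ∑ m, σ.flow (.live m i j) + ∑ m, σ.flow (.static m i j) := rfl

variable [Fintype V]

open Classical in
/-- Number of hops after which data on an efficient route joins the queue of an edge. -/
def startLabel : AlgEdge V c.svc.n → ℕ
  -- Stage `m` owns a block of `card V + 1` labels. The index of a node in an acyclic path is at
  -- most `card V`, also for absent nodes, where `idxOf` returns the length, so it stays inside the
  -- block.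
  | .live m i _ => m * (Fintype.card V + 1) + (σ.livePath m).idxOf i
  | .static m i _ => (σ.staticPath m).idxOf i
  | .replicate _ _ => 0
  | .procLive m i => m * (Fintype.card V + 1) + (σ.livePath m.castSucc).idxOf i
  | .procStatic m i => (σ.staticPath m).idxOf i

open Classical in
/-- Number of hops after which data on an efficient route has crossed an edge. -/
def endLabel : AlgEdge V c.svc.n → ℕ
  | .live m i _ => m * (Fintype.card V + 1) + (σ.livePath m).idxOf i + 1
  | .static m i _ => (σ.staticPath m).idxOf i + 1
  | .replicate _ _ => 0
  -- Live and static data are both processed at the end of block `m`, wherever their paths ended;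
  -- the equal labels keep the processed amounts in the merging ratio at all times.
  | .procLive m _ => (m + 1) * (Fintype.card V + 1)
  | .procStatic m _ => (m + 1) * (Fintype.card V + 1)

open Classical in
/-- Number of hops after which data on an efficient route is delivered. -/
def deliveryLabel : ℕ :=
  c.svc.n * (Fintype.card V + 1) + (σ.livePath (Fin.last _)).idxOf c.dst

lemma merged_flow_mul (p : ℕ → ℝ) : Merged c.svc (fun e => σ.flow e * p (σ.endLabel e)) := by
  classical
  intro m i
  simp only [flow_procLive, flow_procStatic, endLabel]
  ring

lemma idxOf_le_card [DecidableEq V] {l : List V} (hl : l.Nodup) (i : V) :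
    l.idxOf i ≤ Fintype.card V :=
  List.idxOf_le_length.trans hl.length_le_card

/-- This provides the delay of one slot between joining a queue and being served. It holds for all
edges other than replication, on the route or not. -/
lemma startLabel_lt_endLabel {e : AlgEdge V c.svc.n} (he : ∀ m i, e ≠ .replicate m i) :
    σ.startLabel e < σ.endLabel e := by
  classical
  have hs : ∀ m, (σ.staticPath m).Nodup := fun m => by
    obtain ⟨v, -, h⟩ := σ.static_spec m; exact h.2.2.2
  rcases e with ⟨m, i, j⟩ | ⟨m, i, j⟩ | ⟨m, i⟩ | ⟨m, i⟩ | ⟨m, i⟩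
  · simp [startLabel, endLabel]
  · simp [startLabel, endLabel]
  · exact absurd rfl (he m i)
  · have := idxOf_le_card (σ.live_spec m.castSucc).2.2.2 i
    simp only [startLabel, endLabel, add_mul]
    omega
  · have := idxOf_le_card (hs m) i
    simp only [startLabel, endLabel, add_mul]
    omega

lemma endLabel_pos {e : AlgEdge V c.svc.n} (he : ∀ m i, e ≠ .replicate m i) :
    0 < σ.endLabel e := (σ.startLabel_lt_endLabel he).pos

lemma endLabel_le (e : AlgEdge V c.svc.n) :
    σ.endLabel e ≤ (c.svc.n + 1) * (Fintype.card V + 1) := by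
  classical
  have hs : ∀ m, (σ.staticPath m).Nodup := fun m => by
    obtain ⟨v, -, h⟩ := σ.static_spec m; exact h.2.2.2
  rcases e with ⟨m, i, j⟩ | ⟨m, i, j⟩ | ⟨m, i⟩ | ⟨m, i⟩ | ⟨m, i⟩
  · have := idxOf_le_card (σ.live_spec m).2.2.2 i
    have h2 := Nat.mul_le_mul_right (Fintype.card V + 1) (Nat.lt_succ_iff.1 m.2)
    simp only [endLabel, Nat.succ_mul]
    omega
  · have := idxOf_le_card (hs m) i
    have h2 := Nat.mul_le_mul_right (Fintype.card V + 1) (Nat.zero_le c.svc.n)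
    simp only [endLabel, Nat.succ_mul]
    omega
  · simp [endLabel]
  · exact Nat.mul_le_mul_right _ (by omega)
  · exact Nat.mul_le_mul_right _ (by omega)

/-- If data is moved along an efficient route in such a way that the fraction `p d` of it has
made `d` hops, then flow is conserved. -/
lemma conserved_flow_mul (p : ℕ → ℝ) :
    Conserved c (fun e => σ.flow e * p (σ.startLabel e)) (fun e => σ.flow e * p (σ.endLabel e))
      (p 0) (c.svc.cumScale (Fin.last _) * p σ.deliveryLabel) := by
  classical
  -- Conservation on a single path with a clock `q`: both sides are the indicator of `i ∈ l` times
  -- `q (l.idxOf i)`, because a predecessor has index one less and the head has index zero.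
  have key : ∀ (l : List V), l.Nodup → ∀ (q : ℕ → ℝ) (i : V),
      ∑ j, (if [i, j] <:+: l then (1 : ℝ) else 0) * q (l.idxOf i) +
        (if l.getLast? = some i then 1 else 0) * q (l.idxOf i) =
      ∑ j, (if [j, i] <:+: l then (1 : ℝ) else 0) * q (l.idxOf j + 1) +
        (if l.head? = some i then 1 else 0) * q 0 := by
    intro l hl q i
    have h1 := hl.sum_isInfix_pair_add_getLast i
    have h2 := hl.sum_isInfix_pair_add_head i
    have h3 : ∀ j, (if [j, i] <:+: l then (1 : ℝ) else 0) * q (l.idxOf j + 1) =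
        (if [j, i] <:+: l then (1 : ℝ) else 0) * q (l.idxOf i) := by
      intro j
      split_ifs with h
      · rw [hl.idxOf_of_isInfix_pair h]
      · simp
    have h4 : (if l.head? = some i then (1 : ℝ) else 0) * q 0 =
        (if l.head? = some i then (1 : ℝ) else 0) * q (l.idxOf i) := by
      split_ifs with h
      · cases l with
        | nil => simp at h
        | cons a l =>
          obtain rfl : a = i := by simpa using h
          simp
      · simp
    simp only [h3, h4, ← Finset.sum_mul, ← add_mul, h1, h2]
  constructor
  · intro m i
    obtain ⟨ha, hb, -, hn⟩ := σ.live_spec m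
    have h := congrArg (c.svc.cumScale m * ·)
      (key _ hn (fun d => p (m * (Fintype.card V + 1) + d)) i)
    simp only [mul_add (c.svc.cumScale m), Finset.mul_sum, ← add_assoc] at h
    have hl : (Fin.lastCases (motive := fun _ => ℝ)
        (Set.indicator {c.dst} (fun _ => c.svc.cumScale (Fin.last _) * p σ.deliveryLabel) i)
        (fun m' => σ.flow (.procLive m' i) * p (σ.startLabel (.procLive m' i))) m) =
        c.svc.cumScale m * ((if (σ.livePath m).getLast? = some i then 1 else 0) *
          p (m * (Fintype.card V + 1) + (σ.livePath m).idxOf i)) := by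
      rw [hb]
      clear h ha hb hn
      refine Fin.lastCases ?_ (fun m' => ?_) m
      · by_cases hi : i = c.dst
        · simp [hi, deliveryLabel]
        · have hi' : c.dst ≠ i := fun h => hi h.symm
          simp [hi, hi']
      · simp [flow_procLive, startLabel]
    have hr : (Fin.cases (motive := fun _ => ℝ) (Set.indicator {c.src} (fun _ => p 0) i)
        (fun m' => c.svc.scale m' *
          (σ.flow (.procLive m' i) * p (σ.endLabel (.procLive m' i)))) m) =
        c.svc.cumScale m * ((if (σ.livePath m).head? = some i then 1 else 0) *
          p (m * (Fintype.card V + 1) + 0)) := by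
      rw [ha]
      clear h ha hb hn hl
      refine Fin.cases ?_ (fun m' => ?_) m
      · by_cases hi : i = c.src
        · simp [hi, Service.cumScale_zero]
        · have hi' : c.src ≠ i := fun h => hi h.symm
          simp [hi, hi']
      · simp [flow_procLive, endLabel, mul_assoc, Service.cumScale_succ]
    rw [hl, hr]
    simp only [flow_live, startLabel, endLabel, mul_assoc]
    exact h
  · intro m i
    obtain ⟨v, -, ha, hb, -, hn⟩ := σ.static_spec m
    have h := congrArg (c.svc.cumScale m.castSucc * c.svc.merge m * ·) (key _ hn p i)
    rw [hb] at h
    simp only [mul_add, Finset.mul_sum] at h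
    simp only [flow_static, flow_procStatic, flow_replicate, startLabel, endLabel, mul_assoc]
    simpa only [mul_assoc, Option.some.injEq] using h

lemma conserved_flow : Conserved c σ.flow σ.flow 1 (c.svc.cumScale (Fin.last _)) := by
  simpa using σ.conserved_flow_mul fun _ => 1

lemma merged_flow : Merged c.svc σ.flow := by
  simpa using σ.merged_flow_mul fun _ => 1

end EfficientRoute

/-! ### Decomposition of flows into efficient routes -/

/-- In a nonnegative flow on a finite set of nodes, some node at which flow leaves the network can
be reached from any node at which flow enters. -/
lemma exists_reflTransGen_of_flow {V : Type*} [Fintype V] {F : V → V → ℝ} (hF : ∀ i j, 0 ≤ F i j)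
    {ent ext : V → ℝ} (hent : ∀ i, 0 ≤ ent i)
    (bal : ∀ i, ∑ j, F i j + ext i = ∑ j, F j i + ent i) {a : V} (ha : 0 < ent a) :
    ∃ b, Relation.ReflTransGen (fun i j => 0 < F i j) a b ∧ 0 < ext b := by
  classical
  by_contra! hcon
  -- No flow leaves the reachable set `S`. Summing the balance over `S` cancels the inner flow, so
  -- what enters at `a` is at most what exits from `S`, which is nonpositive.
  set S : Finset V := {b | Relation.ReflTransGen (fun i j => 0 < F i j) a b} with hS
  have hout : ∀ i ∈ S, ∑ j, F i j = ∑ j ∈ S, F i j := by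
    intro i hi
    refine (Finset.sum_subset (Finset.subset_univ S) fun j _ hj => ?_).symm
    refine le_antisymm (not_lt.1 fun h => hj ?_) (hF i j)
    rw [hS, Finset.mem_filter] at hi ⊢
    exact ⟨Finset.mem_univ _, hi.2.tail h⟩
  have hinn : ∀ i ∈ S, ∑ j ∈ S, F j i ≤ ∑ j, F j i := fun i _ =>
    Finset.sum_le_sum_of_subset_of_nonneg (Finset.subset_univ S) fun j _ _ => hF j i
  have haS : a ∈ S := by simp [hS, Relation.ReflTransGen.refl]
  have hsum : ∑ i ∈ S, (∑ j, F i j + ext i) = ∑ i ∈ S, (∑ j, F j i + ent i) :=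
    Finset.sum_congr rfl fun i _ => bal i
  rw [Finset.sum_add_distrib, Finset.sum_add_distrib, Finset.sum_congr rfl hout,
    Finset.sum_comm] at hsum
  have h1 := Finset.sum_le_sum hinn
  have h2 : ∑ i ∈ S, ext i ≤ 0 := Finset.sum_nonpos fun i hi => hcon i (by simpa [hS] using hi)
  have h3 : ent a ≤ ∑ i ∈ S, ent i := Finset.single_le_sum (fun i _ => hent i) haS
  linarith

lemma isAcyclicPath_of_flow {V : Type*} {g : Digraph V} {F : V → V → ℝ}
    (hg : ∀ i j, ¬ g.Adj i j → F i j = 0) {a b : V}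
    (h : Relation.ReflTransGen (fun i j => 0 < F i j) a b) :
    ∃ l, IsAcyclicPath g a b l ∧ ∀ i j, [i, j] <:+: l → 0 < F i j := by
  obtain ⟨l, h1, h2, h3, h4⟩ := exists_acyclicPath_of_reflTransGen h
  refine ⟨l, ⟨h1, h2, h3.imp fun i j hij => ?_, h4⟩, fun i j hij => h3.rel_of_isInfix_pair hij⟩
  by_contra hn
  rw [hg i j hn] at hij
  exact lt_irrefl _ hij

instance AlgEdge.instFinite {V : Type*} [Finite V] {n : ℕ} : Finite (AlgEdge V n) := by
  let f : (Fin (n + 1) × V × V) ⊕ (Fin n × V × V) ⊕ (Fin n × V) ⊕ (Fin n × V) ⊕ (Fin n × V) →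
      AlgEdge V n := Sum.elim (fun p => .live p.1 p.2.1 p.2.2)
    (Sum.elim (fun p => .static p.1 p.2.1 p.2.2) (Sum.elim (fun p => .replicate p.1 p.2)
      (Sum.elim (fun p => .procLive p.1 p.2) (fun p => .procStatic p.1 p.2))))
  refine Finite.of_surjective f ?_
  rintro (⟨m, i, j⟩ | ⟨m, i, j⟩ | ⟨m, i⟩ | ⟨m, i⟩ | ⟨m, i⟩)
  · exact ⟨.inl (m, i, j), rfl⟩
  · exact ⟨.inr (.inl (m, i, j)), rfl⟩
  · exact ⟨.inr (.inr (.inl (m, i))), rfl⟩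
  · exact ⟨.inr (.inr (.inr (.inl (m, i)))), rfl⟩
  · exact ⟨.inr (.inr (.inr (.inr (m, i)))), rfl⟩

section Decomposition

variable {V K : Type*} [Fintype V] {G : EdgeCloud V K} {x : Placement V K} {c : Client V K}

/-- Positive flow can be followed stage by stage: from a node with positive entry one reaches a node
with positive exit, which is a processing edge and therefore a positive entry of the next stage.
Merging makes the static flow positive at the same processing nodes. -/
lemma exists_route_of_flow {f : AlgEdge V c.svc.n → ℝ} {inj del : ℝ} (hf : ∀ e, 0 ≤ f e)
    (hsupp : ∀ e, e ∉ algEdges G x c.svc → f e = 0) (hcons : Conserved c f f inj del)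
    (hmerge : Merged c.svc f) (hinj : 0 < inj) :
    ∃ σ : EfficientRoute G x c, ∀ e ∈ σ.edges, 0 < f e := by
  classical
  have : Nonempty V := ⟨c.src⟩
  let ent : Fin (c.svc.n + 1) → V → ℝ := fun m i =>
    Fin.cases (motive := fun _ => ℝ) (Set.indicator {c.src} (fun _ => inj) i)
      (fun m' => c.svc.scale m' * f (.procLive m' i)) m
  let ext : Fin (c.svc.n + 1) → V → ℝ := fun m i =>
    Fin.lastCases (motive := fun _ => ℝ) (Set.indicator {c.dst} (fun _ => del) i)
      (fun m' => f (.procLive m' i)) m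
  have hent : ∀ m i, 0 ≤ ent m i := by
    intro m i
    refine Fin.cases ?_ (fun m' => ?_) m
    · exact Set.indicator_nonneg (fun _ _ => hinj.le) _
    · exact mul_nonneg (c.svc.scale_pos m').le (hf _)
  have hnext : ∀ m a, ∃ b, 0 < ent m a →
      Relation.ReflTransGen (fun i j => 0 < f (.live m i j)) a b ∧ 0 < ext m b := by
    intro m a
    by_cases h : 0 < ent m a
    · obtain ⟨b, hb⟩ := exists_reflTransGen_of_flow (F := fun i j => f (.live m i j))
        (fun i j => hf _) (hent m) (hcons.live m) h
      exact ⟨b, fun _ => hb⟩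
    · exact ⟨a, fun h' => absurd h' h⟩
  choose next hnext using hnext
  let node : Fin (c.svc.n + 1) → V :=
    Fin.induction c.src fun m a => next m.castSucc a
  have hnode : ∀ m : Fin c.svc.n, node m.succ = next m.castSucc (node m.castSucc) := fun _ => rfl
  have hpos : ∀ m, 0 < ent m (node m) := by
    intro m
    induction m using Fin.induction with
    | zero =>
      have : node 0 = c.src := rfl
      simpa [ent, this] using hinj
    | succ m ih =>
      have := (hnext _ _ ih).2
      rw [← hnode] at this
      refine mul_pos (c.svc.scale_pos m) ?_
      simpa [ext] using this
  let loc : Fin c.svc.n → V := fun m => node m.succ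
  have hloc : ∀ m, 0 < f (.procLive m (loc m)) := by
    intro m
    have := (hnext _ _ (hpos m.castSucc)).2
    rw [← hnode] at this
    simpa [ext] using this
  have hstart : ∀ m, Fin.cons (α := fun _ => V) c.src loc m = node m := by
    intro m
    refine Fin.cases ?_ (fun m' => ?_) m
    · rfl
    · simp [loc]
  -- In the last stage flow exits only at the destination, so the node reached there must be
  -- `c.dst`.
  have hend : ∀ m, Fin.snoc (α := fun _ => V) loc c.dst m = next m (node m) := by
    intro m
    refine Fin.lastCases ?_ (fun m' => ?_) m
    · have := (hnext _ _ (hpos (Fin.last _))).2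
      by_contra hne
      rw [Fin.snoc_last] at hne
      simp [ext, Ne.symm hne] at this
    · simp [loc, hnode]
  have hlive : ∀ m, ∃ l, IsAcyclicPath G.graph (Fin.cons (α := fun _ => V) c.src loc m)
      (Fin.snoc (α := fun _ => V) loc c.dst m) l ∧ ∀ i j, [i, j] <:+: l → 0 < f (.live m i j) := by
    intro m
    rw [hstart, hend]
    exact isAcyclicPath_of_flow (F := fun i j => f (.live m i j)) (fun i j h => hsupp _ h)
      (hnext m _ (hpos m)).1
  have hstatic : ∀ m, ∃ v l, 0 < f (.replicate m v) ∧
      IsAcyclicPath G.graph v (loc m) l ∧ ∀ i j, [i, j] <:+: l → 0 < f (.static m i j) := by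
    intro m
    have hps : 0 < f (.procStatic m (loc m)) := by
      rw [hmerge]; exact mul_pos (c.svc.merge_pos m) (hloc m)
    -- The static flow is traced backwards: processing plays the part of entry and replication that
    -- of exit.
    obtain ⟨v, hv, hv'⟩ := exists_reflTransGen_of_flow (F := fun i j => f (.static m j i))
        (ent := fun i => f (.procStatic m i)) (ext := fun i => f (.replicate m i))
        (fun i j => hf _) (fun i => hf _) (fun i => (hcons.static m i).symm) hps
    obtain ⟨l, hl⟩ := isAcyclicPath_of_flow (F := fun i j => f (.static m i j))
      (fun i j h => hsupp _ h) (Relation.reflTransGen_swap.1 hv)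
    exact ⟨v, l, hv', hl⟩
  choose lp hlp hlp' using hlive
  choose v sp hv hsp hsp' using hstatic
  refine ⟨⟨loc, lp, sp, hlp, fun m => ⟨v m, ?_, hsp m⟩⟩, ?_⟩
  · by_contra hn
    exact (hv m).ne' (hsupp _ hn)
  · rintro (⟨m, i, j⟩ | ⟨m, i, j⟩ | ⟨m, i⟩ | ⟨m, i⟩ | ⟨m, i⟩) h
    · exact hlp' m i j h
    · exact hsp' m i j h
    · have h' : (sp m).head? = some i := h
      obtain rfl : v m = i := by simpa [(hsp m).1] using h'
      exact hv m
    · obtain rfl : loc m = i := h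
      exact hloc m
    · obtain rfl : loc m = i := h
      rw [hmerge]; exact mul_pos (c.svc.merge_pos m) (hloc m)

/-- A flow that injects the amount `inj` dominates a combination of efficient routes of total
weight `inj`. -/
lemma exists_decomposition {f : AlgEdge V c.svc.n → ℝ} {inj del : ℝ} (hf : ∀ e, 0 ≤ f e)
    (hsupp : ∀ e, e ∉ algEdges G x c.svc → f e = 0) (hcons : Conserved c f f inj del)
    (hmerge : Merged c.svc f) (hinj : 0 ≤ inj) :
    ∃ w : EfficientRoute G x c → ℝ, (∀ σ, 0 ≤ w σ) ∧ ∑ σ, w σ = inj ∧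
      ∀ e, ∑ σ, w σ * σ.flow e ≤ f e := by
  classical
  -- The total weight is maximized over the compact set of combinations below `f`. Equality with `f`
  -- cannot be expected, since circulations may remain.
  let A : Set (EfficientRoute G x c → ℝ) :=
    {w | (∀ σ, 0 ≤ w σ) ∧ ∑ σ, w σ ≤ inj ∧ ∀ e, ∑ σ, w σ * σ.flow e ≤ f e}
  have hclosed : IsClosed A := by
    refine IsClosed.and ?_ (IsClosed.and ?_ ?_)
    · simp only [Set.ofPred_forall]
      exact isClosed_iInter fun σ => isClosed_le (by fun_prop) (by fun_prop)
    · exact isClosed_le (by fun_prop) (by fun_prop)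
    · simp only [Set.ofPred_forall]
      exact isClosed_iInter fun σ => isClosed_le (by fun_prop) (by fun_prop)
  have hcompact : IsCompact A := by
    refine (isCompact_Icc (a := (0 : EfficientRoute G x c → ℝ)) (b := fun _ => inj)).of_isClosed_subset
      hclosed fun w hw => ⟨hw.1, fun σ => ?_⟩
    exact (Finset.single_le_sum (fun σ _ => hw.1 σ) (Finset.mem_univ σ)).trans hw.2.1
  obtain ⟨w, ⟨hw0, hw1, hw2⟩, hmax⟩ := hcompact.exists_isMaxOn ⟨0, by simp [A, hinj, hf]⟩
    (f := fun w => ∑ σ, w σ) (by fun_prop)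
  refine ⟨w, hw0, le_antisymm hw1 (not_lt.1 fun hlt => ?_), hw2⟩
  -- The residual is conserved and merged by linearity and injects `inj - ∑ σ, w σ > 0`. As there
  -- are finitely many edges, a small multiple of the route found still fits, against maximality.
  obtain ⟨σ₀, hσ₀⟩ := exists_route_of_flow (G := G) (x := x)
    (f := fun e => f e - ∑ σ, w σ * σ.flow e) (fun e => sub_nonneg.2 (hw2 e))
    (fun e he => by simp [hsupp e he, fun σ : EfficientRoute G x c =>
      σ.flow_eq_zero_of_notMem_algEdges he])
    (hcons.sub (Conserved.sum fun σ _ => σ.conserved_flow.smul (w σ)))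
    (fun m i => by
      simp only [hmerge m i, fun σ : EfficientRoute G x c => σ.merged_flow m i, mul_sub,
        Finset.mul_sum, mul_left_comm])
    (by simpa using hlt)
  have hev : ∀ᶠ ε in 𝓝[>] (0 : ℝ), ∀ e, ε * σ₀.flow e ≤ f e - ∑ σ, w σ * σ.flow e := by
    refine eventually_all.2 fun e => ?_
    by_cases he : e ∈ σ₀.edges
    · have : Tendsto (fun ε => ε * σ₀.flow e) (𝓝[>] (0 : ℝ)) (𝓝 (0 * σ₀.flow e)) :=
        (tendsto_nhdsWithin_of_tendsto_nhds tendsto_id).mul_const _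
      rw [zero_mul] at this
      exact (this.eventually_lt_const (hσ₀ e he)).mono fun ε h => h.le
    · refine Eventually.of_forall fun ε => ?_
      rw [σ₀.flow_eq_zero he, mul_zero]
      exact sub_nonneg.2 (hw2 e)
  have hev' : ∀ᶠ ε in 𝓝[>] (0 : ℝ), ε < inj - ∑ σ, w σ :=
    (tendsto_nhdsWithin_of_tendsto_nhds tendsto_id).eventually_lt_const (sub_pos.2 hlt)
  obtain ⟨ε, hε1, hε2, hε⟩ := (hev.and (hev'.and self_mem_nhdsWithin)).exists
  have hε : 0 < ε := hε
  have hsum : ∑ σ, (w σ + Pi.single (M := fun _ => ℝ) σ₀ ε σ) = ∑ σ, w σ + ε := by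
    simp [Finset.sum_add_distrib]
  have hmem : (fun σ => w σ + Pi.single (M := fun _ => ℝ) σ₀ ε σ) ∈ A := by
    refine ⟨fun σ => add_nonneg (hw0 σ) ?_, ?_, fun e => ?_⟩
    · rw [Pi.single_apply]; split_ifs <;> linarith
    · rw [hsum]; linarith
    · have := hε1 e
      simp only [add_mul, Finset.sum_add_distrib, Pi.single_apply, ite_mul, zero_mul,
        Finset.sum_ite_eq', Finset.mem_univ, if_true]
      linarith
  have := hmax hmem
  simp only [Set.mem_ofPred_eq, hsum] at this
  linarith

end Decomposition

/-! ### Total backlog -/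

/-- The sum of a quantity over the requests that one client has raised before slot `t`. -/
def clientSum (α : ℕ → ℕ) (t : ℕ) (g : ℕ → ℕ → ℝ) : ℝ :=
  ∑ τ ∈ Finset.range t, ∑ k ∈ Finset.range (α τ), g τ k

lemma clientSum_add (α : ℕ → ℕ) (t : ℕ) (g h : ℕ → ℕ → ℝ) :
    clientSum α t (fun τ k => g τ k + h τ k) = clientSum α t g + clientSum α t h := by
  simp only [clientSum, Finset.sum_add_distrib]

lemma clientSum_sub (α : ℕ → ℕ) (t : ℕ) (g h : ℕ → ℕ → ℝ) :
    clientSum α t (fun τ k => g τ k - h τ k) = clientSum α t g - clientSum α t h := by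
  simp only [clientSum, Finset.sum_sub_distrib]

lemma clientSum_sum {ι : Type*} (s : Finset ι) (α : ℕ → ℕ) (t : ℕ) (g : ι → ℕ → ℕ → ℝ) :
    clientSum α t (fun τ k => ∑ m ∈ s, g m τ k) = ∑ m ∈ s, clientSum α t (g m) := by
  simp only [clientSum]
  rw [Finset.sum_comm (s := s)]
  exact Finset.sum_congr rfl fun τ _ => Finset.sum_comm

lemma clientSum_mul_left (α : ℕ → ℕ) (t : ℕ) (r : ℝ) (g : ℕ → ℕ → ℝ) :
    clientSum α t (fun τ k => r * g τ k) = r * clientSum α t g := by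
  simp only [clientSum, Finset.mul_sum]

lemma clientSum_le_clientSum {α : ℕ → ℕ} {t : ℕ} {g h : ℕ → ℕ → ℝ}
    (hgh : ∀ τ < t, ∀ k < α τ, g τ k ≤ h τ k) : clientSum α t g ≤ clientSum α t h :=
  Finset.sum_le_sum fun τ hτ => Finset.sum_le_sum fun k hk =>
    hgh τ (Finset.mem_range.1 hτ) k (Finset.mem_range.1 hk)

lemma clientSum_nonneg {α : ℕ → ℕ} {t : ℕ} {g : ℕ → ℕ → ℝ}
    (hg : ∀ τ < t, ∀ k < α τ, 0 ≤ g τ k) : 0 ≤ clientSum α t g :=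
  Finset.sum_nonneg fun τ hτ => Finset.sum_nonneg fun k hk =>
    hg τ (Finset.mem_range.1 hτ) k (Finset.mem_range.1 hk)

lemma requestSum_eq {C : Type*} [Fintype C] (α : ℕ → C → ℕ) (t : ℕ) (g : C → ℕ → ℕ → ℝ) :
    requestSum α t g = ∑ c, clientSum (fun τ => α τ c) t (g c) := rfl

section Backlog

variable {V K C : Type*} [Fintype V] [Fintype C] {cl : C → Client V K}

/-- Total amount of data of one client in the queue of an edge. -/
def edgeBacklog (α : ℕ → C → ℕ) (D : Records cl) (t : ℕ) (c : C)
    (e : AlgEdge V (cl c).svc.n) : ℝ :=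
  clientSum (fun τ => α τ c) t fun τ k => (D c τ k).queued t e

open Classical in
-- The paired amounts occur with opposite signs in the processing and waiting queues, so the minimum
-- disappears and the backlog is linear in the queued amounts.
lemma totalBacklog_eq (G : EdgeCloud V K) (α : ℕ → C → ℕ) (D : Records cl) (t : ℕ) :
    totalBacklog G cl α D t =
      ∑ i, ∑ c, ∑ m, (edgeBacklog α D t c (.procLive m i) +
        edgeBacklog α D t c (.procStatic m i)) +
      ∑ i, ∑ j, if G.graph.Adj i j then ∑ c, (∑ m, edgeBacklog α D t c (.live m i j) +
        ∑ m, edgeBacklog α D t c (.static m i j)) else 0 := by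
  unfold totalBacklog
  congr 1
  · refine Finset.sum_congr rfl fun i _ => ?_
    rw [requestSum_eq, requestSum_eq, ← Finset.sum_add_distrib]
    refine Finset.sum_congr rfl fun c _ => ?_
    rw [← clientSum_add]
    simp only [edgeBacklog, ← clientSum_add, ← clientSum_sum]
    congr 1
    funext τ k
    rw [RequestRecord.procQueue, RequestRecord.waitQueue, ← Finset.sum_add_distrib]
    exact Finset.sum_congr rfl fun m _ => by ring
  · refine Finset.sum_congr rfl fun i _ => Finset.sum_congr rfl fun j _ => ?_
    refine if_congr Iff.rfl ?_ rfl
    rw [requestSum_eq]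
    simp only [edgeBacklog, ← clientSum_add, ← clientSum_sum]
    rfl

end Backlog

/-! ### Releasing requests at a constant rate -/

/-- Number of requests raised before slot `t`. -/
def arrivals (α : ℕ → ℕ) (t : ℕ) : ℕ := ∑ τ ∈ Finset.range t, α τ

lemma arrivals_succ (α : ℕ → ℕ) (t : ℕ) : arrivals α (t + 1) = arrivals α t + α t :=
  Finset.sum_range_succ _ _

lemma arrivals_mono (α : ℕ → ℕ) : Monotone (arrivals α) :=
  monotone_nat_of_le_succ fun t => by rw [arrivals_succ]; omega

lemma arrivals_congr {α β : ℕ → ℕ} {t : ℕ} (h : ∀ τ < t, α τ = β τ) :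
    arrivals α t = arrivals β t :=
  Finset.sum_congr rfl fun τ hτ => h τ (Finset.mem_range.1 hτ)

lemma clientSum_one (α : ℕ → ℕ) (t : ℕ) : clientSum α t (fun _ _ => 1) = arrivals α t := by
  simp [clientSum, arrivals]

/-- Requests are numbered in order of arrival: the `k`-th one of slot `τ` gets the number `arrivals
α τ + k`. -/
lemma clientSum_eq_sum_range (α : ℕ → ℕ) (t : ℕ) (h : ℕ → ℝ) :
    clientSum α t (fun τ k => h (arrivals α τ + k)) = ∑ n ∈ Finset.range (arrivals α t), h n := by
  induction t with
  | zero => simp [clientSum, arrivals]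
  | succ t ih =>
    rw [arrivals_succ, Finset.sum_range_add, ← ih, clientSum, Finset.sum_range_succ]
    rfl

/-- Amount of requests released before slot `t`, when in every slot at most `r` requests are
released. -/
def release (r : ℝ) (α : ℕ → ℕ) : ℕ → ℝ
  | 0 => 0
  -- The cap is `arrivals α t`, not `arrivals α (t + 1)`: a request raised in slot `t` is released
  -- in a later slot.
  | t + 1 => min (release r α t + r) (arrivals α t)

lemma release_congr (r : ℝ) {α β : ℕ → ℕ} {t : ℕ} (h : ∀ τ < t, α τ = β τ) {s : ℕ} (hs : s ≤ t) :
    release r α s = release r β s := by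
  induction s with
  | zero => rfl
  | succ s ih =>
    rw [release, release, ih (by omega), arrivals_congr fun τ hτ => h τ (by omega)]

lemma release_le_arrivals (r : ℝ) (α : ℕ → ℕ) (t : ℕ) : release r α t ≤ arrivals α t := by
  cases t with
  | zero => simp [release]
  | succ t => exact (min_le_right _ _).trans (Nat.cast_le.2 (arrivals_mono α (by omega)))

lemma release_succ_le_arrivals (r : ℝ) (α : ℕ → ℕ) (t : ℕ) :
    release r α (t + 1) ≤ arrivals α t := min_le_right _ _

lemma release_succ_le (r : ℝ) (α : ℕ → ℕ) (t : ℕ) :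
    release r α (t + 1) ≤ release r α t + r := min_le_left _ _

lemma release_mono {r : ℝ} (hr : 0 ≤ r) (α : ℕ → ℕ) : Monotone (release r α) :=
  monotone_nat_of_le_succ fun t => le_min (by linarith) (release_le_arrivals r α t)

lemma release_nonneg {r : ℝ} (hr : 0 ≤ r) (α : ℕ → ℕ) (t : ℕ) : 0 ≤ release r α t :=
  release_mono hr α (Nat.zero_le t)

lemma release_le_release_sub_add {r : ℝ} (hr : 0 ≤ r) (α : ℕ → ℕ) (t d : ℕ) :
    release r α t ≤ release r α (t - d) + r * d := by
  induction d with
  | zero => simp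
  | succ d ih =>
    have : release r α (t - d) ≤ release r α (t - (d + 1)) + r := by
      rcases Nat.lt_or_ge d t with h | h
      · obtain ⟨s, hs⟩ : ∃ s, t - d = s + 1 := ⟨t - d - 1, by omega⟩
        rw [hs, show t - (d + 1) = s by omega]
        exact release_succ_le r α s
      · rw [show t - d = t - (d + 1) by omega]
        linarith
    push_cast
    linarith

/-- Releases never exceed arrivals, which bounds the limit from above. For `b < r`, arrivals
eventually exceed `b * t`; each step of `release` either gains `r` or catches up with the arrivals,
so it stays above `b * t` minus a constant. -/
lemma tendsto_release {r : ℝ} (hr : 0 ≤ r) {α : ℕ → ℕ}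
    (h : Tendsto (fun t : ℕ => (arrivals α t : ℝ) / t) atTop (𝓝 r)) :
    Tendsto (fun t : ℕ => release r α t / t) atTop (𝓝 r) := by
  rw [tendsto_order]
  constructor
  · intro a ha
    obtain ⟨b, hab, hbr⟩ := exists_between ha
    obtain ⟨T, hT⟩ := eventually_atTop.1 (h.eventually_const_lt hbr)
    have hA : ∀ t ≥ T + 1, b * t ≤ arrivals α t := by
      intro t ht
      have htpos : (0 : ℝ) < t := by exact_mod_cast (by omega : 0 < t)
      exact ((lt_div_iff₀ htpos).1 (hT t (by omega))).le
    -- The constant makes the bound nonpositive during the initial slots and later absorbs the lag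
    -- of one slot behind the arrivals.
    have hR : ∀ t : ℕ, b * t - r * (T + 2) ≤ release r α t := by
      intro t
      induction t with
      | zero => simp [release]; positivity
      | succ t ih =>
        rcases Nat.lt_or_ge t (T + 1) with ht | ht
        · refine le_trans ?_ (release_nonneg hr α _)
          have h1 : b * ((t + 1 : ℕ) : ℝ) ≤ r * ((t + 1 : ℕ) : ℝ) := by gcongr
          have h2 : ((t + 1 : ℕ) : ℝ) ≤ T + 2 := by exact_mod_cast (by omega : t + 1 ≤ T + 2)
          have h3 := mul_le_mul_of_nonneg_left h2 hr
          linarith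
        · refine le_min ?_ ?_
          · push_cast; linarith
          · have := hA t ht
            have h2 : 0 ≤ r * (T + 1) := by positivity
            push_cast
            linarith
    have hlim : Tendsto (fun t : ℕ => b - r * (T + 2) / t) atTop (𝓝 (b - 0)) :=
      tendsto_const_nhds.sub (tendsto_const_div_atTop_nhds_zero_nat _)
    rw [sub_zero] at hlim
    filter_upwards [hlim.eventually_const_lt hab, eventually_gt_atTop 0] with t ht htpos
    have htpos : (0 : ℝ) < t := by exact_mod_cast htpos
    refine ht.trans_le ?_
    rw [le_div_iff₀ htpos, sub_mul, div_mul_cancel₀ _ htpos.ne']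
    exact hR t
  · intro a ha
    filter_upwards [h.eventually_lt_const ha] with t ht
    refine lt_of_le_of_lt ?_ ht
    gcongr
    exact release_le_arrivals r α t

lemma tendsto_unreleased {r : ℝ} (hr : 0 ≤ r) {α : ℕ → ℕ}
    (h : Tendsto (fun t : ℕ => (arrivals α t : ℝ) / t) atTop (𝓝 r)) (d : ℕ) :
    Tendsto (fun t : ℕ => (1 / (t : ℝ)) * (arrivals α t - release r α (t - d))) atTop (𝓝 0) := by
  have hlim : Tendsto (fun t : ℕ => (arrivals α t : ℝ) / t - release r α t / t + r * d / t) atTop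
      (𝓝 (r - r + 0)) :=
    (h.sub (tendsto_release hr h)).add (tendsto_const_div_atTop_nhds_zero_nat _)
  rw [sub_self, zero_add] at hlim
  refine squeeze_zero (fun t => ?_) (fun t => ?_) hlim
  · have h1 := release_le_arrivals r α t
    have h2 := release_mono hr α (Nat.sub_le t d)
    exact mul_nonneg (by positivity) (by linarith)
  · rw [← sub_div, ← add_div, one_div, div_eq_inv_mul]
    have := release_le_release_sub_add hr α t d
    gcongr
    linarith

/-- The part of `y` that falls into the unit interval. -/
def unitPart (y : ℝ) : ℝ := max 0 (min 1 y)

lemma unitPart_le_one (y : ℝ) : unitPart y ≤ 1 := max_le zero_le_one (min_le_left _ _)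

lemma unitPart_mono : Monotone unitPart := fun _ _ h => max_le_max_left _ (min_le_min_left _ h)

lemma unitPart_of_nonpos {y : ℝ} (h : y ≤ 0) : unitPart y = 0 :=
  max_eq_left ((min_le_right _ _).trans h)

/-- An amount `y` that fills unit requests in their order puts `unitPart (y - n)` into request `n`.
-/
lemma sum_unitPart_sub {y : ℝ} (hy : 0 ≤ y) (N : ℕ) :
    ∑ n ∈ Finset.range N, unitPart (y - n) = min y N := by
  induction N with
  | zero => simp [hy]
  | succ N ih =>
    rw [Finset.sum_range_succ, ih, unitPart]
    push_cast
    rcases le_total y N with h | h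
    · rw [min_eq_left h, min_eq_right (by linarith), max_eq_left (by linarith),
        min_eq_left (by linarith), add_zero]
    · rcases le_total y (N + 1) with h' | h'
      · rw [min_eq_right h, min_eq_right (by linarith), max_eq_right (by linarith),
          min_eq_left h']
        ring
      · rw [min_eq_right h, min_eq_left (by linarith), max_eq_right zero_le_one, min_eq_right h']

/-- The fraction of the data of the `k`-th request raised in slot `τ` that has made `d` hops before
slot `t`: requests are released in their order at rate `r`, and released data makes a hop per
slot. -/
def hopFraction (r : ℝ) (α : ℕ → ℕ) (τ k t : ℕ) : ℕ → ℝ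
  | 0 => if τ < t then 1 else 0
  -- The first hop happens on release, hence hop `d + 1` before slot `t` means release before slot
  -- `t - d`. Truncated subtraction is harmless because nothing is released before slot zero.
  | d + 1 => unitPart (release r α (t - d) - (arrivals α τ + k : ℕ))

section HopFraction

variable {r : ℝ} {α : ℕ → ℕ} {τ k : ℕ}

lemma hopFraction_le_one (t d : ℕ) : hopFraction r α τ k t d ≤ 1 := by
  cases d with
  | zero => rw [hopFraction]; split_ifs <;> norm_num
  | succ d => exact unitPart_le_one _

lemma hopFraction_zero_left (d : ℕ) : hopFraction r α τ k 0 d = 0 := by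
  cases d with
  | zero => simp [hopFraction]
  | succ d =>
    refine unitPart_of_nonpos ?_
    rw [Nat.zero_sub, release, zero_sub, neg_nonpos]
    positivity

lemma hopFraction_mono (hr : 0 ≤ r) (d : ℕ) : Monotone fun t => hopFraction r α τ k t d := by
  intro s t hst
  cases d with
  | zero =>
    simp only [hopFraction]
    split_ifs <;> first | omega | norm_num
  | succ d =>
    exact unitPart_mono (sub_le_sub_right (release_mono hr α (Nat.sub_le_sub_right hst d)) _)

/-- Later hops lag by at least one slot. For `d = 0` and a request not raised before slot `t`, the
cap in `release` is at most the number of this request, so none of it has moved. -/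
lemma hopFraction_succ_le (hr : 0 ≤ r) (t : ℕ) {d d' : ℕ} (h : d < d') :
    hopFraction r α τ k (t + 1) d' ≤ hopFraction r α τ k t d := by
  obtain ⟨d', rfl⟩ : ∃ e, d' = e + 1 := ⟨d' - 1, by omega⟩
  cases d with
  | zero =>
    rcases Nat.lt_or_ge τ t with hτ | hτ
    · rw [hopFraction.eq_1, if_pos hτ]
      exact hopFraction_le_one _ _
    · rw [hopFraction.eq_1, if_neg (by omega)]
      refine (unitPart_of_nonpos ?_).le
      have h1 := release_mono hr α (Nat.sub_le (t + 1) d')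
      have h2 := release_succ_le_arrivals r α t
      have h3 : (arrivals α t : ℝ) ≤ (arrivals α τ + k : ℕ) :=
        Nat.cast_le.2 ((arrivals_mono α hτ).trans (by omega))
      linarith
  | succ d =>
    exact unitPart_mono (sub_le_sub_right (release_mono hr α (by omega)) _)

lemma hopFraction_antitone (hr : 0 ≤ r) (t : ℕ) : Antitone (hopFraction r α τ k t) := by
  intro d d' h
  rcases h.eq_or_lt with rfl | h
  · exact le_rfl
  · exact (hopFraction_mono hr d' (Nat.le_succ t)).trans (hopFraction_succ_le hr t h)

lemma hopFraction_congr {β : ℕ → ℕ} {t : ℕ} (h : ∀ s < t, α s = β s) (hτ : τ < t) :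
    hopFraction r α τ k t = hopFraction r β τ k t := by
  funext d
  cases d with
  | zero => rfl
  | succ d =>
    rw [hopFraction, hopFraction, release_congr r h (Nat.sub_le t d),
      arrivals_congr fun s hs => h s (hs.trans hτ)]

/-- Since `release r α (t + 1) ≤ arrivals α t`, the requests raised before slot `t` account for all
that is released up to time `t + 1`. -/
lemma clientSum_hopFraction_succ (hr : 0 ≤ r) {s t : ℕ} (d : ℕ) (hs : s ≤ t + 1) :
    clientSum α t (fun τ k => hopFraction r α τ k s (d + 1)) = release r α (s - d) := by
  simp only [hopFraction]
  rw [clientSum_eq_sum_range α t fun n => unitPart (release r α (s - d) - n),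
    sum_unitPart_sub (release_nonneg hr α _), min_eq_left]
  exact (release_mono hr α (by omega)).trans (release_succ_le_arrivals r α t)

lemma clientSum_hopFraction_zero (t : ℕ) :
    clientSum α t (fun τ k => hopFraction r α τ k t 0) = arrivals α t := by
  rw [← clientSum_one]
  refine Finset.sum_congr rfl fun τ hτ => Finset.sum_congr rfl fun k _ => ?_
  exact if_pos (Finset.mem_range.1 hτ)

/-- Every hop inherits the pace of the release. Hop zero is excluded because it follows the
arrivals, which may come in bursts. -/
lemma clientSum_hopFraction_step_le (hr : 0 ≤ r) (t : ℕ) {d : ℕ} (hd : 0 < d) :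
    clientSum α t (fun τ k => hopFraction r α τ k (t + 1) d - hopFraction r α τ k t d) ≤ r := by
  obtain ⟨d, rfl⟩ : ∃ e, d = e + 1 := ⟨d - 1, by omega⟩
  rw [clientSum_sub, clientSum_hopFraction_succ hr d le_rfl,
    clientSum_hopFraction_succ hr d (Nat.le_succ t)]
  rcases Nat.lt_or_ge t d with h | h
  · rw [show t + 1 - d = t - d by omega]; linarith
  · rw [show t + 1 - d = t - d + 1 by omega]
    linarith [release_succ_le r α (t - d)]

end HopFraction

/-! ### A stabilizing policy -/

section PacedRecord

variable {V K : Type*} [Fintype V] {G : EdgeCloud V K} {x : Placement V K} {c : Client V K}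

/-- The history of a request that is split among the efficient routes in the proportions `P`,
when the fraction `p t d` of its data has made `d` hops before slot `t`. -/
def pacedRecord (P : EfficientRoute G x c → ℝ) (p : ℕ → ℕ → ℝ) : RequestRecord V c.svc.n where
  route e := ∑ σ, P σ * σ.flow e
  joined t e := ∑ σ, P σ * (σ.flow e * p t (σ.startLabel e))
  crossed t e := ∑ σ, P σ * (σ.flow e * p t (σ.endLabel e))
  delivered t := ∑ σ, P σ * (c.svc.cumScale (Fin.last _) * p t σ.deliveryLabel)

lemma isAdmissibleRoute_combination {P : EfficientRoute G x c → ℝ} (hP : ∀ σ, 0 ≤ P σ)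
    (hP1 : ∑ σ, P σ = 1) : IsAdmissibleRoute G x c (fun e => ∑ σ, P σ * σ.flow e) where
  nonneg e := Finset.sum_nonneg fun σ _ => mul_nonneg (hP σ) (σ.flow_nonneg e)
  support e he := Finset.sum_eq_zero fun σ _ => by
    rw [σ.flow_eq_zero_of_notMem_algEdges he, mul_zero]
  conserved := by
    have h := Conserved.sum (s := Finset.univ) fun σ _ =>
      (EfficientRoute.conserved_flow (G := G) (x := x) (c := c) σ).smul (P σ)
    simpa [← Finset.sum_mul, hP1] using h
  merged m i := by
    rw [Finset.mul_sum]
    exact Finset.sum_congr rfl fun σ _ => by rw [σ.merged_flow m i]; ring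

/-- Legality is linear in the routes, so each clause reduces to one property of `p`: `hsucc` gives
the service delay, and conservation and merging hold on each route for any `p`. -/
lemma pacedRecord_isLegal {P : EfficientRoute G x c → ℝ} (hP : ∀ σ, 0 ≤ P σ)
    (hP1 : ∑ σ, P σ = 1) {p : ℕ → ℕ → ℝ} {τ : ℕ} (hmono : ∀ d, Monotone fun t => p t d)
    (hle : ∀ t d, p t d ≤ 1) (hzero : ∀ d, p 0 d = 0)
    (hp : ∀ t, p t 0 = if τ < t then 1 else 0)
    (hsucc : ∀ t d d', d < d' → p (t + 1) d' ≤ p t d) :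
    (pacedRecord P p).IsLegal G x c τ where
  route_admissible := isAdmissibleRoute_combination hP hP1
  joined_mono s t hst e := Finset.sum_le_sum fun σ _ =>
    mul_le_mul_of_nonneg_left (mul_le_mul_of_nonneg_left (hmono _ hst) (σ.flow_nonneg e)) (hP σ)
  crossed_mono s t hst e := Finset.sum_le_sum fun σ _ =>
    mul_le_mul_of_nonneg_left (mul_le_mul_of_nonneg_left (hmono _ hst) (σ.flow_nonneg e)) (hP σ)
  delivered_mono s t hst := Finset.sum_le_sum fun σ _ =>
    mul_le_mul_of_nonneg_left
      (mul_le_mul_of_nonneg_left (hmono _ hst) (c.svc.cumScale_pos _).le) (hP σ)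
  crossed_zero := by
    funext e
    exact Finset.sum_eq_zero fun σ _ => by simp [hzero]
  delivered_zero := Finset.sum_eq_zero fun σ _ => by simp [hzero]
  joined_le_route t e := Finset.sum_le_sum fun σ _ =>
    mul_le_mul_of_nonneg_left (mul_le_of_le_one_right (σ.flow_nonneg e) (hle _ _)) (hP σ)
  delivered_le t := by
    have h : ∀ σ ∈ Finset.univ, P σ * (c.svc.cumScale (Fin.last _) * p t σ.deliveryLabel) ≤
        P σ * c.svc.cumScale (Fin.last _) := fun σ _ =>
      mul_le_mul_of_nonneg_left
        (mul_le_of_le_one_right (c.svc.cumScale_pos _).le (hle _ _)) (hP σ)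
    refine (Finset.sum_le_sum h).trans ?_
    rw [← Finset.sum_mul, hP1, one_mul]
  replicated t m i := by
    simp only [pacedRecord, EfficientRoute.endLabel, hp]
    split_ifs <;> simp
  crossed_le_joined t e he := Finset.sum_le_sum fun σ _ =>
    mul_le_mul_of_nonneg_left (mul_le_mul_of_nonneg_left
      (hsucc t _ _ (σ.startLabel_lt_endLabel he)) (σ.flow_nonneg e)) (hP σ)
  conserved t := by
    have h := Conserved.sum (s := Finset.univ) fun σ _ =>
      (EfficientRoute.conserved_flow_mul (G := G) (x := x) (c := c) σ (p t)).smul (P σ)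
    rw [← Finset.sum_mul, hP1, one_mul, hp] at h
    exact h
  merged t m i := by
    simp only [pacedRecord, Finset.mul_sum]
    refine Finset.sum_congr rfl fun σ _ => ?_
    have := σ.merged_flow_mul (p t) m i
    simp only at this
    rw [this]
    ring

lemma clientSum_served_pacedRecord_le {P : EfficientRoute G x c → ℝ} (hP : ∀ σ, 0 ≤ P σ)
    {r : ℝ} (hr : 0 ≤ r) (α : ℕ → ℕ) (t : ℕ) {e : AlgEdge V c.svc.n}
    (he : ∀ m i, e ≠ .replicate m i) :
    clientSum α t (fun τ k => (pacedRecord P (hopFraction r α τ k)).served t e) ≤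
      r * ∑ σ, P σ * σ.flow e := by
  have h : ∀ τ k, (pacedRecord P (hopFraction r α τ k)).served t e = ∑ σ, P σ * σ.flow e *
      (hopFraction r α τ k (t + 1) (σ.endLabel e) - hopFraction r α τ k t (σ.endLabel e)) := by
    intro τ k
    simp only [RequestRecord.served, pacedRecord, ← Finset.sum_sub_distrib]
    exact Finset.sum_congr rfl fun σ _ => by ring
  simp only [h, clientSum_sum, clientSum_mul_left]
  rw [mul_comm, Finset.sum_mul]
  exact Finset.sum_le_sum fun σ _ => mul_le_mul_of_nonneg_left
    (clientSum_hopFraction_step_le hr t (σ.endLabel_pos he)) (mul_nonneg (hP σ) (σ.flow_nonneg e))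

lemma tendsto_queued_pacedRecord {P : EfficientRoute G x c → ℝ} (hP : ∀ σ, 0 ≤ P σ)
    {r : ℝ} (hr : 0 ≤ r) {α : ℕ → ℕ}
    (h : Tendsto (fun t : ℕ => (arrivals α t : ℝ) / t) atTop (𝓝 r)) {e : AlgEdge V c.svc.n}
    (he : ∀ m i, e ≠ .replicate m i) :
    Tendsto (fun t : ℕ => (1 / (t : ℝ)) *
      clientSum α t fun τ k => (pacedRecord P (hopFraction r α τ k)).queued t e) atTop (𝓝 0) := by
  set d := (c.svc.n + 1) * (Fintype.card V + 1) with hd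
  have hq : ∀ τ k t, (pacedRecord P (hopFraction r α τ k)).queued t e = ∑ σ, P σ * σ.flow e *
      (hopFraction r α τ k t (σ.startLabel e) - hopFraction r α τ k t (σ.endLabel e)) := by
    intro τ k t
    simp only [RequestRecord.queued, pacedRecord, ← Finset.sum_sub_distrib]
    exact Finset.sum_congr rfl fun σ _ => by ring
  have hlim := (tendsto_unreleased hr h d).const_mul (∑ σ, P σ * σ.flow e)
  rw [mul_zero] at hlim
  refine squeeze_zero (fun t => ?_) (fun t => ?_) hlim
  · refine mul_nonneg (by positivity) (clientSum_nonneg fun τ _ k _ => ?_)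
    rw [hq]
    exact Finset.sum_nonneg fun σ _ => mul_nonneg (mul_nonneg (hP σ) (σ.flow_nonneg e))
      (sub_nonneg.2 (hopFraction_antitone hr t (σ.startLabel_lt_endLabel he).le))
  · rw [mul_left_comm]
    refine mul_le_mul_of_nonneg_left ?_ (by positivity)
    rw [← clientSum_hopFraction_zero, ← clientSum_hopFraction_succ hr (s := t) (t := t) d
      (Nat.le_succ t), ← clientSum_sub, ← clientSum_mul_left]
    refine clientSum_le_clientSum fun τ _ k _ => ?_
    rw [hq, Finset.sum_mul]
    refine Finset.sum_le_sum fun σ _ => mul_le_mul_of_nonneg_left ?_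
      (mul_nonneg (hP σ) (σ.flow_nonneg e))
    -- All labels lie between 0 and `d + 1`, so the queued fraction is at most what has arrived
    -- without having made `d + 1` hops. Summed over requests this is the arrivals minus `release r
    -- α (t - d)`.
    exact sub_le_sub (hopFraction_antitone hr t (Nat.zero_le _))
      (hopFraction_antitone hr t ((σ.endLabel_le e).trans (Nat.le_succ _)))

end PacedRecord

section PacedPolicy

variable {V K C : Type*} [Fintype V] [Fintype C] {G : EdgeCloud V K} {cl : C → Client V K}
  {x : Placement V K}

/-- The decisions that split every request of client `c` among the efficient routes in the
proportions `prob c`, and release the requests of client `c` at rate `rate c`. -/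
def pacedRecords (rate : C → ℝ≥0) (prob : (c : C) → EfficientRoute G x (cl c) → ℝ)
    (α : ℕ → C → ℕ) : Records cl :=
  fun c τ k => pacedRecord (prob c) (hopFraction (rate c) (fun s => α s c) τ k)

variable {rate : C → ℝ≥0} {prob : (c : C) → EfficientRoute G x (cl c) → ℝ}

lemma pacedRecords_isAdmissible (hprob : IsRouteDistribution prob)
    (hnode : ∀ i, expNodeLoad rate prob i ≤ G.nodeCap i)
    (hlink : ∀ i j, G.graph.Adj i j → expLinkLoad rate prob i j ≤ G.linkCap i j)
    (α : ℕ → C → ℕ) : IsAdmissible G cl x α (pacedRecords rate prob α) where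
  legal c τ k _ := pacedRecord_isLegal (hprob c).2 (hprob c).1
    (hopFraction_mono (rate c).2) hopFraction_le_one hopFraction_zero_left (fun _ => rfl)
    (fun t _ _ h => hopFraction_succ_le (rate c).2 t h)
  node_capacity t i := by
    refine le_trans ?_ (hnode i)
    rw [requestSum_eq]
    refine Finset.sum_le_sum fun c _ => ?_
    simp only [RequestRecord.nodeUse, clientSum_sum, clientSum_mul_left]
    have h : ∀ m ∈ Finset.univ, _ := fun m (_ : m ∈ Finset.univ) => mul_le_mul_of_nonneg_left
      (clientSum_served_pacedRecord_le (P := prob c) (hprob c).2 (rate c).2 (fun s => α s c) t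
        (e := .procLive m i) (by simp)) ((cl c).svc.work_nonneg m)
    refine (Finset.sum_le_sum h).trans_eq ?_
    simp only [EfficientRoute.nodeLoad_eq, Finset.mul_sum, Finset.sum_mul]
    rw [Finset.sum_comm]
    exact Finset.sum_congr rfl fun σ _ => Finset.sum_congr rfl fun m _ => by
      simp only [NNReal.val_eq_coe]; ring
  link_capacity t i j hij := by
    refine le_trans ?_ (hlink i j hij)
    rw [requestSum_eq]
    refine Finset.sum_le_sum fun c _ => ?_
    simp only [RequestRecord.linkUse, clientSum_sum, clientSum_add]
    have h1 : ∀ m ∈ Finset.univ, _ := fun m (_ : m ∈ Finset.univ) =>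
      clientSum_served_pacedRecord_le (P := prob c) (hprob c).2 (rate c).2 (fun s => α s c) t
        (e := .live m i j) (by simp)
    have h2 : ∀ m ∈ Finset.univ, _ := fun m (_ : m ∈ Finset.univ) =>
      clientSum_served_pacedRecord_le (P := prob c) (hprob c).2 (rate c).2 (fun s => α s c) t
        (e := .static m i j) (by simp)
    refine (add_le_add (Finset.sum_le_sum h1) (Finset.sum_le_sum h2)).trans_eq ?_
    rw [← Finset.mul_sum, ← Finset.mul_sum, ← mul_add, Finset.sum_comm,
      Finset.sum_comm (s := Finset.univ (α := Fin (cl c).svc.n)), ← Finset.sum_add_distrib]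
    congr 1
    refine Finset.sum_congr rfl fun σ _ => ?_
    rw [σ.linkLoad_eq, ← Finset.mul_sum, ← Finset.mul_sum]
    ring

lemma tendsto_sum_zero {ι κ : Type*} [Fintype ι] {l : Filter κ} {f : ι → κ → ℝ}
    (h : ∀ k, Tendsto (f k) l (𝓝 0)) : Tendsto (fun t => ∑ k, f k t) l (𝓝 0) := by
  simpa using tendsto_finsetSum Finset.univ fun k _ => h k

lemma tendsto_totalBacklog_pacedRecords (hprob : IsRouteDistribution prob) {α : ℕ → C → ℕ}
    (h : ∀ c, Tendsto (fun t : ℕ => (arrivals (fun s => α s c) t : ℝ) / t) atTop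
      (𝓝 (rate c : ℝ))) :
    Tendsto (fun t : ℕ => (1 / (t : ℝ)) * totalBacklog G cl α (pacedRecords rate prob α) t)
      atTop (𝓝 0) := by
  classical
  have key : ∀ c (e : AlgEdge V (cl c).svc.n), (∀ m i, e ≠ .replicate m i) →
      Tendsto (fun t : ℕ => (1 / (t : ℝ)) * edgeBacklog α (pacedRecords rate prob α) t c e)
        atTop (𝓝 0) := fun c e he =>
    tendsto_queued_pacedRecord (hprob c).2 (rate c).2 (h c) he
  simp only [totalBacklog_eq, mul_add, Finset.mul_sum, mul_ite, mul_zero]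
  have hadd : ∀ {f g : ℕ → ℝ}, Tendsto f atTop (𝓝 0) → Tendsto g atTop (𝓝 0) →
      Tendsto (fun t => f t + g t) atTop (𝓝 0) := fun hf hg => by simpa using hf.add hg
  refine hadd (tendsto_sum_zero fun i => tendsto_sum_zero fun c => tendsto_sum_zero fun m =>
    hadd (key _ _ (by simp)) (key _ _ (by simp))) (tendsto_sum_zero fun i => tendsto_sum_zero fun j => ?_)
  split_ifs
  · exact tendsto_sum_zero fun c => hadd (tendsto_sum_zero fun m => key _ _ (by simp))
      (tendsto_sum_zero fun m => key _ _ (by simp))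
  · exact tendsto_const_nhds

/-- The policy that makes the decisions `pacedRecords`. -/
def pacedPolicy (hprob : IsRouteDistribution prob)
    (hnode : ∀ i, expNodeLoad rate prob i ≤ G.nodeCap i)
    (hlink : ∀ i j, G.graph.Adj i j → expLinkLoad rate prob i j ≤ G.linkCap i j) :
    Policy G cl x where
  run _ α := pacedRecords rate prob α
  admissible _ α := pacedRecords_isAdmissible hprob hnode hlink α
  causal_route _ _ _ _ _ _ _ _ := rfl
  causal_schedule _ α β t h c τ hτ k _ := by
    have := hopFraction_congr (r := rate c) (α := fun s => α s c) (β := fun s => β s c) (k := k)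
      (fun s hs => congrFun (h s hs) c) hτ
    simp only [pacedRecords, pacedRecord, this, and_self]
  measurable_route _ _ _ _ _ := measurable_const
  measurable_joined _ _ _ _ _ _ := measurable_const
  measurable_crossed _ _ _ _ _ _ := measurable_const
  measurable_delivered _ _ _ _ _ := measurable_const

end PacedPolicy

/-! ### Arrival processes -/

section Arrivals

variable {Ω C : Type*} [MeasurableSpace Ω] {P : Measure Ω} {a : ℕ → Ω → C → ℕ} {rate : C → ℝ≥0}

/-- The strong law, for one client at a time; independence between clients plays no role. -/
lemma IsArrivalProcess.tendsto_arrivals [IsFiniteMeasure P] (ha : IsArrivalProcess P a rate)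
    (c : C) : ∀ᵐ ω ∂P, Tendsto (fun t : ℕ => (arrivals (fun τ => a τ ω c) t : ℝ) / t) atTop
      (𝓝 (rate c : ℝ)) := by
  have hm : Measurable fun n : ℕ => (n : ℝ) := measurable_from_top
  obtain ⟨A, hA⟩ := ha.bounded c
  have hint : Integrable (fun ω => (a 0 ω c : ℝ)) P := by
    refine Integrable.of_bound (hm.comp (ha.measurable 0 c)).aestronglyMeasurable A ?_
    filter_upwards [hA 0] with ω hω
    simpa using hω
  have := strong_law_ae_real (fun t ω => (a t ω c : ℝ)) hint
    (fun i j hij => ((ha.indep c).indepFun hij).comp hm hm)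
    (fun t => (ha.identDistrib t c).comp hm)
  filter_upwards [this] with ω hω
  simpa [arrivals, ha.mean c] using hω

lemma IsArrivalProcess.isStabilizable {V K : Type*} [Fintype V] [Fintype C] [IsFiniteMeasure P]
    {G : EdgeCloud V K} {cl : C → Client V K} {x : Placement V K}
    {prob : (c : C) → EfficientRoute G x (cl c) → ℝ} (ha : IsArrivalProcess P a rate)
    (hprob : IsRouteDistribution prob) (hnode : ∀ i, expNodeLoad rate prob i ≤ G.nodeCap i)
    (hlink : ∀ i j, G.graph.Adj i j → expLinkLoad rate prob i j ≤ G.linkCap i j) :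
    IsStabilizable G cl x P a := by
  refine ⟨pacedPolicy hprob hnode hlink, ?_⟩
  refine Measure.quasiMeasurePreserving_fst.ae
    (p := fun ω => Tendsto (fun t : ℕ => (1 / (t : ℝ)) * totalBacklog G cl (fun τ => a τ ω)
      (pacedRecords rate prob (fun τ => a τ ω)) t) atTop (𝓝 0)) ?_
  filter_upwards [ae_all_iff.2 ha.tendsto_arrivals] with ω hω
  exact tendsto_totalBacklog_pacedRecords hprob hω

/-- There are arrival processes of any given rates. -/
lemma exists_isArrivalProcess {C : Type*} (rate : C → ℝ≥0) :
    ∃ (Ω : Type) (_ : MeasurableSpace Ω) (P : Measure Ω) (_ : IsProbabilityMeasure P)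
      (a : ℕ → Ω → C → ℕ), IsArrivalProcess P a rate := by
  let P : Measure (ℕ → unitInterval) := Measure.infinitePi fun _ => volume
  -- Each slot brings the integer part of the rate plus a Bernoulli variable whose mean is the
  -- fractional part. All clients may share the same uniform variable.
  let p : C → unitInterval := fun c => ⟨rate c - ⌊(rate c : ℝ)⌋₊,
    sub_nonneg.2 (Nat.floor_le (rate c).2),
    by linarith [Nat.lt_floor_add_one (rate c : ℝ)]⟩
  let F : C → unitInterval → ℕ := fun c u =>
    ⌊(rate c : ℝ)⌋₊ + (Set.Iio (p c)).indicator (fun _ => 1) u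
  have hF : ∀ c, Measurable (F c) := fun c =>
    measurable_const.add (measurable_const.indicator measurableSet_Iio)
  have heval : ∀ t, MeasurePreserving (fun ω : ℕ → unitInterval => ω t) P volume := fun t =>
    measurePreserving_eval_infinitePi (fun _ : ℕ => (volume : Measure unitInterval)) t
  refine ⟨ℕ → unitInterval, inferInstance, P, inferInstance, fun t ω c => F c (ω t), ?_, ?_, ?_,
    ?_, ?_⟩
  · exact fun t c => (hF c).comp (measurable_pi_apply t)
  · exact fun c => iIndepFun_infinitePi fun _ => hF c
  · intro t c
    have h : IdentDistrib (fun ω : ℕ → unitInterval => ω t) (fun ω => ω 0) P P :=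
      ⟨(heval t).measurable.aemeasurable, (heval 0).measurable.aemeasurable,
        (heval t).map_eq.trans (heval 0).map_eq.symm⟩
    exact h.comp (hF c)
  · refine fun c => ⟨⌊(rate c : ℝ)⌋₊ + 1, fun t => Eventually.of_forall fun ω => ?_⟩
    simp only [F, Set.indicator_apply]
    split_ifs <;> omega
  · intro c
    have hm : Measurable fun n : ℕ => (n : ℝ) := measurable_from_top
    have h1 : ∫ ω, (F c (ω 0) : ℝ) ∂P = ∫ u, (F c u : ℝ) := by
      rw [← (heval 0).map_eq, integral_map (f := fun u => (F c u : ℝ))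
        (heval 0).measurable.aemeasurable (hm.comp (hF c)).aestronglyMeasurable]
    have h2 : ∀ u, (F c u : ℝ) =
        (⌊(rate c : ℝ)⌋₊ : ℝ) + (Set.Iio (p c)).indicator (fun _ => (1 : ℝ)) u := by
      intro u
      simp only [F, Set.indicator_apply]
      split_ifs <;> simp
    rw [h1, integral_congr_ae (Eventually.of_forall h2), integral_add (integrable_const _)
      ((integrable_const _).indicator measurableSet_Iio), integral_indicator_const _
      measurableSet_Iio, measureReal_def, unitInterval.volume_Iio,
      ENNReal.toReal_ofReal (p c).2.1]
    simp [p]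

end Arrivals

/-! ### Bounds for admissible routes and legal histories -/

section Legal

variable {V K : Type*} [Fintype V] {G : EdgeCloud V K} {x : Placement V K} {c : Client V K}

/-- Summing conservation over all nodes cancels transport. This bounds processing per request, which
capacities cannot do when the workload is zero. -/
lemma IsAdmissibleRoute.sum_procLive {f : AlgEdge V c.svc.n → ℝ}
    (hf : IsAdmissibleRoute G x c f) (m : Fin c.svc.n) :
    ∑ i, f (.procLive m i) = c.svc.cumScale m.castSucc := by
  let ent : Fin (c.svc.n + 1) → V → ℝ := fun m i =>
    Fin.cases (motive := fun _ => ℝ) (Set.indicator {c.src} (fun _ => 1) i)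
      (fun m' => c.svc.scale m' * f (.procLive m' i)) m
  have hstep : ∀ m : Fin c.svc.n, ∑ i, f (.procLive m i) = ∑ i, ent m.castSucc i := by
    intro m
    have h := Finset.sum_congr (rfl : (Finset.univ : Finset V) = _) fun i _ =>
      hf.conserved.live m.castSucc i
    rw [Finset.sum_add_distrib, Finset.sum_add_distrib, Finset.sum_comm] at h
    simpa using add_left_cancel h
  have hent : ∀ m, ∑ i, ent m i = c.svc.cumScale m := by
    classical
    intro m
    induction m using Fin.induction with
    | zero => simp [ent, Set.indicator_apply, Service.cumScale_zero]
    | succ m ih =>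
      rw [Service.cumScale_succ, ← ih, ← hstep, Finset.mul_sum]
      rfl
  rw [hstep, hent]

lemma IsAdmissibleRoute.sum_procStatic {f : AlgEdge V c.svc.n → ℝ}
    (hf : IsAdmissibleRoute G x c f) (m : Fin c.svc.n) :
    ∑ i, f (.procStatic m i) = c.svc.cumScale m.castSucc * c.svc.merge m := by
  simp only [fun i => hf.merged m i, ← Finset.mul_sum]
  rw [hf.sum_procLive, mul_comm]

lemma IsAdmissibleRoute.sum_replicate {f : AlgEdge V c.svc.n → ℝ}
    (hf : IsAdmissibleRoute G x c f) (m : Fin c.svc.n) :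
    ∑ i, f (.replicate m i) = c.svc.cumScale m.castSucc * c.svc.merge m := by
  have h := Finset.sum_congr (rfl : (Finset.univ : Finset V) = _) fun i _ =>
    hf.conserved.static m i
  rw [Finset.sum_add_distrib, Finset.sum_add_distrib, Finset.sum_comm] at h
  rw [← hf.sum_procStatic]
  exact (add_left_cancel h).symm

namespace RequestRecord.IsLegal

variable {τ : ℕ} {R : RequestRecord V c.svc.n} (h : R.IsLegal G x c τ)
include h

lemma crossed_nonneg (t : ℕ) (e : AlgEdge V c.svc.n) : 0 ≤ R.crossed t e := by
  have := h.crossed_mono (Nat.zero_le t) e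
  rwa [h.crossed_zero] at this

lemma delivered_nonneg (t : ℕ) : 0 ≤ R.delivered t :=
  h.delivered_zero.symm.le.trans (h.delivered_mono (Nat.zero_le t))

lemma queued_nonneg (t : ℕ) {e : AlgEdge V c.svc.n} (he : ∀ m i, e ≠ .replicate m i) :
    0 ≤ R.queued t e :=
  sub_nonneg.2 ((h.crossed_mono (Nat.le_succ t) e).trans (h.crossed_le_joined t e he))

lemma joined_nonneg (t : ℕ) {e : AlgEdge V c.svc.n} (he : ∀ m i, e ≠ .replicate m i) :
    0 ≤ R.joined t e :=
  (h.crossed_nonneg t e).trans (sub_nonneg.1 (h.queued_nonneg t he))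

lemma crossed_le_route (t : ℕ) (e : AlgEdge V c.svc.n) : R.crossed t e ≤ R.route e := by
  by_cases he : ∀ m i, e ≠ .replicate m i
  · exact (sub_nonneg.1 (h.queued_nonneg t he)).trans (h.joined_le_route t e)
  · push Not at he
    obtain ⟨m, i, rfl⟩ := he
    rw [h.replicated]
    split_ifs
    · exact le_rfl
    · exact h.route_admissible.nonneg _

lemma crossed_eq_zero {t : ℕ} {e : AlgEdge V c.svc.n} (he : e ∉ algEdges G x c.svc) :
    R.crossed t e = 0 :=
  le_antisymm ((h.crossed_le_route t e).trans_eq (h.route_admissible.support e he))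
    (h.crossed_nonneg t e)

lemma queued_eq_zero {t : ℕ} {e : AlgEdge V c.svc.n} (he : e ∉ algEdges G x c.svc)
    (he' : ∀ m i, e ≠ .replicate m i) : R.queued t e = 0 := by
  refine le_antisymm ?_ (h.queued_nonneg t he')
  have h1 := h.joined_le_route t e
  rw [h.route_admissible.support e he] at h1
  have h2 := h.crossed_nonneg t e
  rw [RequestRecord.queued]
  linarith

/-- Nothing is queued for a request before its arrival. -/
lemma joined_eq_zero_of_crossed {t : ℕ} (ht : t ≤ τ) (hc : ∀ e, R.crossed t e = 0)
    {e : AlgEdge V c.svc.n} (he : ∀ m i, e ≠ .replicate m i) : R.joined t e = 0 := by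
  have hlive : ∀ m i, (∀ j, R.joined t (.live m i j) = 0) ∧
      Fin.lastCases (motive := fun _ => ℝ)
        (Set.indicator {c.dst} (fun _ => R.delivered t) i)
          (fun m' => R.joined t (.procLive m' i)) m = 0 := by
    intro m i
    have hcons := (h.conserved t).live m i
    -- Nothing flows in before the injection, so the nonnegative outgoing amounts sum to zero and
    -- all vanish.
    have hr : (Fin.cases (motive := fun _ => ℝ)
        (Set.indicator {c.src} (fun _ => if τ < t then (1 : ℝ) else 0) i)
        (fun m' => c.svc.scale m' * R.crossed t (.procLive m' i)) m) = 0 := by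
      clear hcons
      refine Fin.cases ?_ (fun m' => ?_) m
      · simp [not_lt.2 ht]
      · simp [hc]
    have hl : 0 ≤ (Fin.lastCases (motive := fun _ => ℝ)
        (Set.indicator {c.dst} (fun _ => R.delivered t) i)
          (fun m' => R.joined t (.procLive m' i)) m) := by
      clear hcons hr
      refine Fin.lastCases ?_ (fun m' => ?_) m
      · simpa using Set.indicator_nonneg (fun _ _ => h.delivered_nonneg t) i
      · simpa using h.joined_nonneg t (by simp)
    have hn : ∀ j ∈ Finset.univ, 0 ≤ R.joined t (.live m i j) :=
      fun j _ => h.joined_nonneg t (by simp)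
    rw [hr] at hcons
    simp only [hc, Finset.sum_const_zero, add_zero] at hcons
    have h1 := Finset.sum_nonneg hn
    refine ⟨fun j => ?_, by linarith⟩
    exact (Finset.sum_eq_zero_iff_of_nonneg hn).1 (by linarith) j (Finset.mem_univ j)
  have hstatic : ∀ m i, (∀ j, R.joined t (.static m i j) = 0) ∧
      R.joined t (.procStatic m i) = 0 := by
    intro m i
    have hcons := (h.conserved t).static m i
    have hn : ∀ j ∈ Finset.univ, 0 ≤ R.joined t (.static m i j) :=
      fun j _ => h.joined_nonneg t (by simp)
    have hl : 0 ≤ R.joined t (.procStatic m i) := h.joined_nonneg t (by simp)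
    simp only [hc, Finset.sum_const_zero, add_zero] at hcons
    have h1 := Finset.sum_nonneg hn
    refine ⟨fun j => ?_, by linarith⟩
    exact (Finset.sum_eq_zero_iff_of_nonneg hn).1 (by linarith) j (Finset.mem_univ j)
  rcases e with ⟨m, i, j⟩ | ⟨m, i, j⟩ | ⟨m, i⟩ | ⟨m, i⟩ | ⟨m, i⟩
  · exact (hlive m i).1 j
  · exact (hstatic m i).1 j
  · exact absurd rfl (he m i)
  · simpa using (hlive m.castSucc i).2
  · exact (hstatic m i).2

/-- The bound reaches `τ + 1` because service in slot `τ` draws on what was queued at its beginning.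
Hence the capacity constraint of a slot, which counts only earlier requests, misses no service. -/
lemma crossed_eq_zero_of_le {t : ℕ} (ht : t ≤ τ + 1) {e : AlgEdge V c.svc.n}
    (he : ∀ m i, e ≠ .replicate m i) : R.crossed t e = 0 := by
  induction t generalizing e with
  | zero => rw [h.crossed_zero]; rfl
  | succ t ih =>
    refine le_antisymm ((h.crossed_le_joined t e he).trans_eq ?_) (h.crossed_nonneg _ _)
    refine h.joined_eq_zero_of_crossed (by omega) (fun e' => ?_) he
    by_cases he' : ∀ m i, e' ≠ .replicate m i
    · exact ih (by omega) he'
    · push Not at he'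
      obtain ⟨m, i, rfl⟩ := he'
      rw [h.replicated, if_neg (by omega)]

end RequestRecord.IsLegal

end Legal

/-! ### The limit flow of a stable network -/

/-- Requests raised in slot `t` contribute nothing at time `t + 1`, so cumulative amounts are sums
of increments of requests that were already present. -/
lemma clientSum_telescope {α : ℕ → ℕ} {g : ℕ → ℕ → ℕ → ℝ}
    (hg : ∀ τ, ∀ k < α τ, ∀ s ≤ τ + 1, g s τ k = 0) (t : ℕ) :
    clientSum α t (g t) =
      ∑ s ∈ Finset.range t, clientSum α s fun τ k => g (s + 1) τ k - g s τ k := by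
  induction t with
  | zero => simp [clientSum]
  | succ t ih =>
    rw [Finset.sum_range_succ, ← ih, clientSum_sub, add_sub_cancel, clientSum,
      Finset.sum_range_succ, Finset.sum_eq_zero (s := Finset.range (α t)), add_zero]
    · rfl
    · exact fun k hk => hg t k (Finset.mem_range.1 hk) _ le_rfl

section Limit

variable {V K C : Type*} [Fintype V] [Fintype C] {G : EdgeCloud V K} {cl : C → Client V K}
  {x : Placement V K} {α : ℕ → C → ℕ} {D : Records cl}

/-- Total amount of data of one client that has crossed an edge. -/
def edgeCrossed (α : ℕ → C → ℕ) (D : Records cl) (t : ℕ) (c : C)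
    (e : AlgEdge V (cl c).svc.n) : ℝ :=
  clientSum (fun τ => α τ c) t fun τ k => (D c τ k).crossed t e

namespace IsAdmissible

variable (h : IsAdmissible G cl x α D)
include h

lemma edgeCrossed_nonneg (t : ℕ) (c : C) (e : AlgEdge V (cl c).svc.n) :
    0 ≤ edgeCrossed α D t c e :=
  clientSum_nonneg fun τ _ k hk => (h.legal c τ k hk).crossed_nonneg t e

lemma edgeBacklog_nonneg (t : ℕ) (c : C) {e : AlgEdge V (cl c).svc.n}
    (he : ∀ m i, e ≠ .replicate m i) : 0 ≤ edgeBacklog α D t c e :=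
  clientSum_nonneg fun τ _ k hk => (h.legal c τ k hk).queued_nonneg t he

lemma edgeCrossed_eq_zero (t : ℕ) (c : C) {e : AlgEdge V (cl c).svc.n}
    (he : e ∉ algEdges G x (cl c).svc) : edgeCrossed α D t c e = 0 := by
  unfold edgeCrossed clientSum
  exact Finset.sum_eq_zero fun τ _ => Finset.sum_eq_zero fun k hk =>
    (h.legal c τ k (Finset.mem_range.1 hk)).crossed_eq_zero he

lemma edgeBacklog_eq_zero (t : ℕ) (c : C) {e : AlgEdge V (cl c).svc.n}
    (he : e ∉ algEdges G x (cl c).svc) (he' : ∀ m i, e ≠ .replicate m i) :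
    edgeBacklog α D t c e = 0 := by
  unfold edgeBacklog clientSum
  exact Finset.sum_eq_zero fun τ _ => Finset.sum_eq_zero fun k hk =>
    (h.legal c τ k (Finset.mem_range.1 hk)).queued_eq_zero he he'

lemma edgeCrossed_eq_sum_served (t : ℕ) (c : C) {e : AlgEdge V (cl c).svc.n}
    (he : ∀ m i, e ≠ .replicate m i) :
    edgeCrossed α D t c e = ∑ s ∈ Finset.range t,
      clientSum (fun τ => α τ c) s fun τ k => (D c τ k).served s e :=
  clientSum_telescope (g := fun s τ k => (D c τ k).crossed s e)
    (fun τ k hk _ hs => (h.legal c τ k hk).crossed_eq_zero_of_le hs he) t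

lemma edgeBacklog_le_totalBacklog (t : ℕ) (c : C) {e : AlgEdge V (cl c).svc.n}
    (he : ∀ m i, e ≠ .replicate m i) : edgeBacklog α D t c e ≤ totalBacklog G cl α D t := by
  classical
  rw [totalBacklog_eq]
  have hn : ∀ c {e : AlgEdge V (cl c).svc.n}, (∀ m i, e ≠ .replicate m i) →
      0 ≤ edgeBacklog α D t c e := fun c _ he => h.edgeBacklog_nonneg t c he
  have h1 : ∀ i c m, 0 ≤ edgeBacklog α D t c (.procLive m i) +
      edgeBacklog α D t c (.procStatic m i) := fun i c m =>
    add_nonneg (hn c (by simp)) (hn c (by simp))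
  have h2 : ∀ i c, 0 ≤ ∑ m, (edgeBacklog α D t c (.procLive m i) +
      edgeBacklog α D t c (.procStatic m i)) := fun i c => Finset.sum_nonneg fun m _ => h1 i c m
  have h3 : ∀ i, 0 ≤ ∑ c, ∑ m, (edgeBacklog α D t c (.procLive m i) +
      edgeBacklog α D t c (.procStatic m i)) := fun i => Finset.sum_nonneg fun c _ => h2 i c
  have h4 : ∀ c i j, 0 ≤ ∑ m, edgeBacklog α D t c (.live m i j) := fun c i j =>
    Finset.sum_nonneg fun m _ => hn c (by simp)
  have h5 : ∀ c i j, 0 ≤ ∑ m, edgeBacklog α D t c (.static m i j) := fun c i j =>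
    Finset.sum_nonneg fun m _ => hn c (by simp)
  have h6 : ∀ i j, 0 ≤ if G.graph.Adj i j then ∑ c, (∑ m, edgeBacklog α D t c (.live m i j) +
      ∑ m, edgeBacklog α D t c (.static m i j)) else 0 := by
    intro i j
    split_ifs
    · exact Finset.sum_nonneg fun c _ => add_nonneg (h4 c i j) (h5 c i j)
    · exact le_rfl
  have h7 : ∀ i, 0 ≤ ∑ j, if G.graph.Adj i j then
      ∑ c, (∑ m, edgeBacklog α D t c (.live m i j) +
      ∑ m, edgeBacklog α D t c (.static m i j)) else 0 := fun i =>
    Finset.sum_nonneg fun j _ => h6 i j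
  have hproc : ∀ m i, edgeBacklog α D t c (.procLive m i) +
      edgeBacklog α D t c (.procStatic m i) ≤ _ := fun m i =>
    ((Finset.single_le_sum (fun m _ => h1 i c m) (Finset.mem_univ m)).trans
      (Finset.single_le_sum (fun c _ => h2 i c) (Finset.mem_univ c))).trans
      (Finset.single_le_sum (fun i _ => h3 i) (Finset.mem_univ i))
  have hlink : ∀ i j, G.graph.Adj i j → ∑ m, edgeBacklog α D t c (.live m i j) +
      ∑ m, edgeBacklog α D t c (.static m i j) ≤ _ := fun i j hij =>
    ((Finset.single_le_sum (fun c _ => add_nonneg (h4 c i j) (h5 c i j))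
      (Finset.mem_univ c)).trans_eq (if_pos hij).symm).trans
      ((Finset.single_le_sum (fun j _ => h6 i j) (Finset.mem_univ j)).trans
      (Finset.single_le_sum (fun i _ => h7 i) (Finset.mem_univ i)))
  have h8 := Finset.sum_nonneg fun i (_ : i ∈ Finset.univ) => h3 i
  have h9 := Finset.sum_nonneg fun i (_ : i ∈ Finset.univ) => h7 i
  by_cases hmem : e ∈ algEdges G x (cl c).svc
  · rcases e with ⟨m, i, j⟩ | ⟨m, i, j⟩ | ⟨m, i⟩ | ⟨m, i⟩ | ⟨m, i⟩
    · have := Finset.single_le_sum (f := fun m => edgeBacklog α D t c (.live m i j))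
        (fun m _ => hn c (by simp)) (Finset.mem_univ m)
      linarith [hlink i j hmem, h5 c i j]
    · have := Finset.single_le_sum (f := fun m => edgeBacklog α D t c (.static m i j))
        (fun m _ => hn c (by simp)) (Finset.mem_univ m)
      linarith [hlink i j hmem, h4 c i j]
    · exact absurd rfl (he m i)
    · linarith [hproc m i, hn c (e := .procStatic m i) (by simp)]
    · linarith [hproc m i, hn c (e := .procLive m i) (by simp)]
  · rw [h.edgeBacklog_eq_zero t c hmem he]
    exact add_nonneg h8 h9

lemma sum_edgeCrossed_node_le (t : ℕ) (i : V) :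
    ∑ c, ∑ m, (cl c).svc.work m * edgeCrossed α D t c (.procLive m i) ≤ t * G.nodeCap i := by
  have h1 : ∀ c m, edgeCrossed α D t c (.procLive m i) = _ := fun c m =>
    h.edgeCrossed_eq_sum_served t c (e := .procLive m i) (by simp)
  have h2 := Finset.sum_le_sum fun s (_ : s ∈ Finset.range t) => h.node_capacity s i
  simp only [Finset.sum_const, Finset.card_range, nsmul_eq_mul] at h2
  refine le_trans (le_of_eq ?_) h2
  simp only [requestSum_eq, h1, RequestRecord.nodeUse, clientSum_sum, clientSum_mul_left,
    Finset.mul_sum]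
  rw [Finset.sum_comm (s := Finset.range t)]
  exact Finset.sum_congr rfl fun c _ => Finset.sum_comm

lemma sum_edgeCrossed_link_le (t : ℕ) {i j : V} (hij : G.graph.Adj i j) :
    ∑ c, (∑ m, edgeCrossed α D t c (.live m i j) + ∑ m, edgeCrossed α D t c (.static m i j)) ≤
      t * G.linkCap i j := by
  have h1 : ∀ c m, edgeCrossed α D t c (.live m i j) = _ := fun c m =>
    h.edgeCrossed_eq_sum_served t c (e := .live m i j) (by simp)
  have h1' : ∀ c m, edgeCrossed α D t c (.static m i j) = _ := fun c m =>
    h.edgeCrossed_eq_sum_served t c (e := .static m i j) (by simp)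
  have h2 := Finset.sum_le_sum fun s (_ : s ∈ Finset.range t) => h.link_capacity s i j hij
  simp only [Finset.sum_const, Finset.card_range, nsmul_eq_mul] at h2
  refine le_trans (le_of_eq ?_) h2
  simp only [requestSum_eq, h1, h1', RequestRecord.linkUse, clientSum_sum, clientSum_add]
  rw [Finset.sum_comm (s := Finset.range t)]
  refine Finset.sum_congr rfl fun c _ => ?_
  rw [Finset.sum_add_distrib]
  congr 1 <;> exact Finset.sum_comm

/-- Up to a constant depending on the edge, the amount of data that has crossed an edge is bounded
by the number of slots and the number of requests. -/
lemma exists_edgeCrossed_le (c : C) (e : AlgEdge V (cl c).svc.n) :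
    ∃ b, 0 ≤ b ∧ ∀ t : ℕ, edgeCrossed α D t c e ≤ b * (t + arrivals (fun τ => α τ c) t) := by
  have hn := fun t c => h.edgeCrossed_nonneg t c
  -- Two sources of bounds: a route may circulate, so transmission is bounded by link capacity and
  -- time; processing and replication are bounded per request by the totals of an admissible route.
  have hroute : ∀ b, 0 ≤ b → (∀ f, IsAdmissibleRoute G x (cl c) f → f e ≤ b) →
      ∃ b, 0 ≤ b ∧ ∀ t : ℕ, edgeCrossed α D t c e ≤ b * (t + arrivals (fun τ => α τ c) t) := by
    intro b hb hle
    refine ⟨b, hb, fun t => ?_⟩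
    have h1 : edgeCrossed α D t c e ≤ b * arrivals (fun τ => α τ c) t := by
      rw [← clientSum_one, ← clientSum_mul_left]
      refine clientSum_le_clientSum fun τ _ k hk => ?_
      rw [mul_one]
      exact ((h.legal c τ k hk).crossed_le_route t e).trans
        (hle _ (h.legal c τ k hk).route_admissible)
    have : 0 ≤ b * (t : ℝ) := by positivity
    linarith
  have hcum := fun m => ((cl c).svc.cumScale_pos m).le
  have hmerge := fun m => ((cl c).svc.merge_pos m).le
  by_cases he : e ∈ algEdges G x (cl c).svc
  · have hcap : ∀ b, 0 ≤ b → (∀ t : ℕ, edgeCrossed α D t c e ≤ t * b) →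
        ∃ b, 0 ≤ b ∧ ∀ t : ℕ, edgeCrossed α D t c e ≤ b * (t + arrivals (fun τ => α τ c) t) := by
      intro b hb hle
      refine ⟨b, hb, fun t => ?_⟩
      have : 0 ≤ b * (arrivals (fun τ => α τ c) t : ℝ) := by positivity
      linarith [hle t]
    have hlink : ∀ i j, G.graph.Adj i j → ∀ t : ℕ, ∑ m, edgeCrossed α D t c (.live m i j) +
        ∑ m, edgeCrossed α D t c (.static m i j) ≤ t * G.linkCap i j := fun i j hij t =>
      (Finset.single_le_sum (f := fun c => ∑ m, edgeCrossed α D t c (.live m i j) +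
        ∑ m, edgeCrossed α D t c (.static m i j))
        (fun c _ => add_nonneg (Finset.sum_nonneg fun m _ => hn t c _)
          (Finset.sum_nonneg fun m _ => hn t c _)) (Finset.mem_univ c)).trans
        (h.sum_edgeCrossed_link_le t hij)
    rcases e with ⟨m, i, j⟩ | ⟨m, i, j⟩ | ⟨m, i⟩ | ⟨m, i⟩ | ⟨m, i⟩
    · refine hcap _ (G.linkCap_pos i j he).le fun t => ?_
      have h1 := Finset.single_le_sum (f := fun m => edgeCrossed α D t c (.live m i j))
        (fun m _ => hn t c _) (Finset.mem_univ m)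
      have h2 : 0 ≤ ∑ m, edgeCrossed α D t c (.static m i j) :=
        Finset.sum_nonneg fun m _ => hn t c _
      linarith [hlink i j he t]
    · refine hcap _ (G.linkCap_pos i j he).le fun t => ?_
      have h1 := Finset.single_le_sum (f := fun m => edgeCrossed α D t c (.static m i j))
        (fun m _ => hn t c _) (Finset.mem_univ m)
      have h2 : 0 ≤ ∑ m, edgeCrossed α D t c (.live m i j) :=
        Finset.sum_nonneg fun m _ => hn t c _
      linarith [hlink i j he t]
    · exact hroute _ (mul_nonneg (hcum m.castSucc) (hmerge m)) fun f hf =>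
        (Finset.single_le_sum (f := fun i => f (.replicate m i)) (fun i _ => hf.nonneg _)
          (Finset.mem_univ i)).trans_eq (hf.sum_replicate m)
    · exact hroute _ (hcum m.castSucc) fun f hf =>
        (Finset.single_le_sum (f := fun i => f (.procLive m i)) (fun i _ => hf.nonneg _)
          (Finset.mem_univ i)).trans_eq (hf.sum_procLive m)
    · exact hroute _ (mul_nonneg (hcum m.castSucc) (hmerge m)) fun f hf =>
        (Finset.single_le_sum (f := fun i => f (.procStatic m i)) (fun i _ => hf.nonneg _)
          (Finset.mem_univ i)).trans_eq (hf.sum_procStatic m)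
  · exact hroute 0 le_rfl fun f hf => (hf.support e he).le

end IsAdmissible

lemma Ultrafilter.exists_tendsto_of_eventually_mem_Icc {ι : Type*} (U : Ultrafilter ι)
    {u : ι → ℝ} {a b : ℝ} (h : ∀ᶠ k in U, u k ∈ Set.Icc a b) : ∃ y, Tendsto u U (𝓝 y) := by
  obtain ⟨y, -, hy⟩ := (isCompact_Icc (a := a) (b := b)).ultrafilter_le_nhds (U.map u)
    (le_principal_iff.2 h)
  exact ⟨y, hy⟩

/-- In a stable network, the time averages of the data that has crossed the edges converge, along
an ultrafilter, to flows that carry the arrival rates. -/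
lemma IsAdmissible.exists_flow (h : IsAdmissible G cl x α D) {rate : C → ℝ≥0}
    (hrate : ∀ c, Tendsto (fun t : ℕ => (arrivals (fun s => α s c) t : ℝ) / t) atTop
      (𝓝 (rate c : ℝ)))
    (hstable : Tendsto (fun t : ℕ => (1 / (t : ℝ)) * totalBacklog G cl α D t) atTop (𝓝 0)) :
    ∃ (f : (c : C) → AlgEdge V (cl c).svc.n → ℝ) (del : C → ℝ),
      (∀ c e, 0 ≤ f c e) ∧ (∀ c, ∀ e ∉ algEdges G x (cl c).svc, f c e = 0) ∧
      (∀ c, Conserved (cl c) (f c) (f c) (rate c) (del c)) ∧ (∀ c, Merged (cl c).svc (f c)) ∧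
      (∀ i, ∑ c, ∑ m, (cl c).svc.work m * f c (.procLive m i) ≤ G.nodeCap i) ∧
      (∀ i j, G.graph.Adj i j →
        ∑ c, (∑ m, f c (.live m i j) + ∑ m, f c (.static m i j)) ≤ G.linkCap i j) := by
  -- One ultrafilter provides the limits for all clients and edges at once, in place of successive
  -- subsequences.
  set U : Ultrafilter ℕ := hyperfilter ℕ
  have hU : (U : Filter ℕ) ≤ atTop := Nat.hyperfilter_le_atTop
  have hbound : ∀ c, ∀ᶠ t : ℕ in U,
      0 < (t : ℝ) ∧ (arrivals (fun s => α s c) t : ℝ) ≤ (rate c + 1) * t := by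
    intro c
    refine hU ?_
    filter_upwards [(hrate c).eventually_lt_const (lt_add_one _), eventually_gt_atTop 0]
      with t ht ht0
    have ht0 : (0 : ℝ) < t := Nat.cast_pos.2 ht0
    exact ⟨ht0, ((div_lt_iff₀ ht0).1 ht).le⟩
  have hf : ∀ c (e : AlgEdge V (cl c).svc.n),
      ∃ y, Tendsto (fun t : ℕ => (1 / (t : ℝ)) * edgeCrossed α D t c e) U (𝓝 y) := by
    intro c e
    obtain ⟨b, hb, hle⟩ := h.exists_edgeCrossed_le c e
    refine U.exists_tendsto_of_eventually_mem_Icc (a := 0) (b := b * (1 + (rate c + 1))) ?_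
    filter_upwards [hbound c] with t ⟨ht0, ht⟩
    refine ⟨mul_nonneg (by positivity) (h.edgeCrossed_nonneg t c e), ?_⟩
    rw [one_div, inv_mul_le_iff₀ ht0]
    refine (hle t).trans ?_
    rw [mul_left_comm]
    exact mul_le_mul_of_nonneg_left (by linarith) hb
  have hd : ∀ c, ∃ y, Tendsto (fun t : ℕ => (1 / (t : ℝ)) *
      clientSum (fun τ => α τ c) t fun τ k => (D c τ k).delivered t) U (𝓝 y) := by
    intro c
    have hcum := ((cl c).svc.cumScale_pos (Fin.last _)).le
    refine U.exists_tendsto_of_eventually_mem_Icc (a := 0)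
      (b := (cl c).svc.cumScale (Fin.last _) * (rate c + 1)) ?_
    filter_upwards [hbound c] with t ⟨ht0, ht⟩
    refine ⟨mul_nonneg (by positivity)
      (clientSum_nonneg fun τ _ k hk => (h.legal c τ k hk).delivered_nonneg t), ?_⟩
    rw [one_div, inv_mul_le_iff₀ ht0]
    refine (clientSum_le_clientSum (h := fun _ _ => (cl c).svc.cumScale (Fin.last _) * 1)
      fun τ _ k hk => ?_).trans ?_
    · rw [mul_one]; exact (h.legal c τ k hk).delivered_le t
    · rw [clientSum_mul_left, clientSum_one, mul_left_comm]
      exact mul_le_mul_of_nonneg_left (by linarith) hcum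
  choose f hf using hf
  choose del hdel using hd
  have hback : ∀ c (e : AlgEdge V (cl c).svc.n), (∀ m i, e ≠ .replicate m i) →
      Tendsto (fun t : ℕ => (1 / (t : ℝ)) * edgeBacklog α D t c e) U (𝓝 0) := fun c e he =>
    squeeze_zero (fun t => mul_nonneg (by positivity) (h.edgeBacklog_nonneg t c he))
      (fun t => mul_le_mul_of_nonneg_left (h.edgeBacklog_le_totalBacklog t c he) (by positivity))
      (hstable.mono_left hU)
  refine ⟨f, del, fun c e => ?_, fun c e he => ?_, fun c => ?_, fun c m i => ?_, fun i => ?_,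
    fun i j hij => ?_⟩
  · exact ge_of_tendsto' (hf c e) fun t =>
      mul_nonneg (by positivity) (h.edgeCrossed_nonneg t c e)
  · refine tendsto_nhds_unique (hf c e) ?_
    simp only [h.edgeCrossed_eq_zero _ c he, mul_zero]
    exact tendsto_const_nhds
  · refine Conserved.of_tendsto (l := (U : Filter ℕ))
      (out := fun (t : ℕ) e => (1 / (t : ℝ)) *
        clientSum (fun τ => α τ c) t fun τ k => (D c τ k).joined t e)
      (inn := fun (t : ℕ) e => (1 / (t : ℝ)) * edgeCrossed α D t c e)
      (inj := fun (t : ℕ) => (1 / (t : ℝ)) *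
        clientSum (fun τ => α τ c) t fun τ k => if τ < t then 1 else 0)
      (fun t => ?_) (fun e he => ?_) (hf c) ?_ (hdel c)
    · exact (Conserved.sum fun τ _ => Conserved.sum fun k hk =>
        (h.legal c τ k (Finset.mem_range.1 hk)).conserved t).smul _
    -- The joined amounts are the crossed amounts plus the backlog, which vanishes in the limit:
    -- here stability yields conservation.
    · have := (hf c e).add (hback c e he)
      rw [add_zero] at this
      refine this.congr fun t => ?_
      rw [← mul_add, edgeCrossed, edgeBacklog, ← clientSum_add]
      simp only [RequestRecord.queued, add_sub_cancel]
    · refine ((hrate c).mono_left hU).congr fun t => ?_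
      rw [div_eq_inv_mul, one_div, ← clientSum_one]
      congr 1
      refine Finset.sum_congr rfl fun τ hτ => Finset.sum_congr rfl fun k _ => ?_
      exact (if_pos (Finset.mem_range.1 hτ)).symm
  · refine tendsto_nhds_unique (hf c _) (((hf c (.procLive m i)).const_mul _).congr fun t => ?_)
    rw [mul_left_comm]
    congr 1
    rw [edgeCrossed, ← clientSum_mul_left]
    refine Finset.sum_congr rfl fun τ _ => Finset.sum_congr rfl fun k hk => ?_
    exact ((h.legal c τ k (Finset.mem_range.1 hk)).merged t m i).symm
  · refine le_of_tendsto (tendsto_finsetSum _ fun c _ => tendsto_finsetSum _ fun m _ =>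
      (hf c (.procLive m i)).const_mul _) (hU ?_)
    filter_upwards [eventually_gt_atTop 0] with t ht
    have ht : (0 : ℝ) < t := Nat.cast_pos.2 ht
    simp only [mul_left_comm _ (1 / (t : ℝ)), ← Finset.mul_sum]
    rw [one_div, inv_mul_le_iff₀ ht]
    exact h.sum_edgeCrossed_node_le t i
  · refine le_of_tendsto (tendsto_finsetSum _ fun c _ => Tendsto.add
      (tendsto_finsetSum _ fun m _ => hf c (.live m i j))
      (tendsto_finsetSum _ fun m _ => hf c (.static m i j))) (hU ?_)
    filter_upwards [eventually_gt_atTop 0] with t ht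
    have ht : (0 : ℝ) < t := Nat.cast_pos.2 ht
    simp only [← Finset.mul_sum, ← mul_add]
    rw [one_div, inv_mul_le_iff₀ ht]
    exact h.sum_edgeCrossed_link_le t hij

end Limit

/-! ### Characterization of the stability region -/

section Region

variable {V K C : Type*} [Fintype V] [Fintype C] {G : EdgeCloud V K} {cl : C → Client V K}
  {x : Placement V K} {rate : C → ℝ≥0}

/-- A policy provides every client with an efficient route. -/
lemma Policy.exists_routeDistribution (π : Policy G cl x) (c : C) :
    ∃ w : EfficientRoute G x (cl c) → ℝ, (∀ σ, 0 ≤ w σ) ∧ ∑ σ, w σ = 1 := by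
  -- A policy must handle every arrival sequence, in particular one request per client and slot; the
  -- route of such a request is decomposed.
  have h := (((π.admissible 0 fun _ _ => 1).legal c 0 0 one_pos)).route_admissible
  obtain ⟨w, hw, hw1, -⟩ := exists_decomposition h.nonneg h.support h.conserved h.merged
    zero_le_one
  exact ⟨w, hw, hw1⟩

/-- A stabilizable arrival process satisfies the load constraints. -/
lemma IsArrivalProcess.exists_prob {Ω : Type*} [MeasurableSpace Ω] {P : Measure Ω}
    [IsProbabilityMeasure P] {a : ℕ → Ω → C → ℕ} (ha : IsArrivalProcess P a rate)
    (hstab : IsStabilizable G cl x P a) :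
    ∃ prob : (c : C) → EfficientRoute G x (cl c) → ℝ, IsRouteDistribution prob ∧
      (∀ i, expNodeLoad rate prob i ≤ G.nodeCap i) ∧
      (∀ i j, G.graph.Adj i j → expLinkLoad rate prob i j ≤ G.linkCap i j) := by
  obtain ⟨π, hπ⟩ := hstab
  have hω := Measure.quasiMeasurePreserving_fst (μ := P) (ν := (volume : Measure unitInterval)).ae
    (ae_all_iff.2 ha.tendsto_arrivals)
  obtain ⟨⟨ω, u⟩, hstable, hrate⟩ := (hπ.and hω).exists
  obtain ⟨f, del, hf0, hsupp, hcons, hmerge, hnode, hlink⟩ :=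
    (π.admissible u fun τ => a τ ω).exists_flow hrate hstable
  choose w hw0 hw1 hw using fun c =>
    exists_decomposition (hf0 c) (hsupp c) (hcons c) (hmerge c) (rate c).2
  have hprob : ∀ c, ∃ p : EfficientRoute G x (cl c) → ℝ, (∑ σ, p σ = 1 ∧ ∀ σ, 0 ≤ p σ) ∧
      ∀ σ, (rate c : ℝ) * p σ = w c σ := by
    intro c
    -- At rate zero all weights vanish and cannot be normalized, so any distribution on the routes
    -- will do.
    by_cases hr : (rate c : ℝ) = 0
    · obtain ⟨p, hp, hp1⟩ := π.exists_routeDistribution c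
      refine ⟨p, ⟨hp1, hp⟩, fun σ => ?_⟩
      rw [hr, zero_mul]
      exact ((Finset.sum_eq_zero_iff_of_nonneg fun σ _ => hw0 c σ).1 ((hw1 c).trans hr) σ
        (Finset.mem_univ σ)).symm
    · refine ⟨fun σ => w c σ / rate c, ⟨?_, fun σ => div_nonneg (hw0 c σ) (rate c).2⟩,
        fun σ => mul_div_cancel₀ _ hr⟩
      rw [← Finset.sum_div, hw1]
      exact div_self hr
  choose prob hdist hprob using hprob
  have hload : ∀ c (l : EfficientRoute G x (cl c) → ℝ),
      (rate c : ℝ) * ∑ σ, l σ * prob c σ = ∑ σ, w c σ * l σ := by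
    intro c l
    rw [Finset.mul_sum]
    exact Finset.sum_congr rfl fun σ _ => by rw [← hprob c σ]; ring
  refine ⟨prob, hdist, fun i => le_trans ?_ (hnode i), fun i j hij => le_trans ?_ (hlink i j hij)⟩
  · refine Finset.sum_le_sum fun c _ => ?_
    rw [hload]
    simp only [EfficientRoute.nodeLoad_eq, Finset.mul_sum]
    rw [Finset.sum_comm]
    refine Finset.sum_le_sum fun m _ => ?_
    simp only [mul_left_comm (w c _), ← Finset.mul_sum]
    exact mul_le_mul_of_nonneg_left (hw c _) ((cl c).svc.work_nonneg m)
  · refine Finset.sum_le_sum fun c _ => ?_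
    rw [hload]
    simp only [EfficientRoute.linkLoad_eq, mul_add, Finset.mul_sum, Finset.sum_add_distrib]
    exact add_le_add (Finset.sum_comm.trans_le (Finset.sum_le_sum fun m _ => hw c _))
      (Finset.sum_comm.trans_le (Finset.sum_le_sum fun m _ => hw c _))

/-- The forward direction needs some process of the given rates, for otherwise membership would be
vacuous. -/
lemma mem_stabilityRegion_iff :
    rate ∈ stabilityRegion G cl x ↔
      ∃ prob : (c : C) → EfficientRoute G x (cl c) → ℝ, IsRouteDistribution prob ∧
        (∀ i, expNodeLoad rate prob i ≤ G.nodeCap i) ∧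
        (∀ i j, G.graph.Adj i j → expLinkLoad rate prob i j ≤ G.linkCap i j) := by
  constructor
  · intro h
    obtain ⟨Ω, _, P, _, a, ha⟩ := exists_isArrivalProcess rate
    exact ha.exists_prob (h Ω P a ha)
  · rintro ⟨prob, hprob, hnode, hlink⟩ Ω _ P _ a ha
    exact ha.isStabilizable hprob hnode hlink

lemma expNodeLoad_smul (r : ℝ≥0) (prob : (c : C) → EfficientRoute G x (cl c) → ℝ) (i : V) :
    expNodeLoad (r • rate) prob i = r * expNodeLoad rate prob i := by
  simp [expNodeLoad, Finset.mul_sum, mul_assoc]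

lemma expLinkLoad_smul (r : ℝ≥0) (prob : (c : C) → EfficientRoute G x (cl c) → ℝ) (i j : V) :
    expLinkLoad (r • rate) prob i j = r * expLinkLoad rate prob i j := by
  simp [expLinkLoad, Finset.mul_sum, mul_assoc]

lemma mem_interior_stabilityRegion_iff :
    rate ∈ interior (stabilityRegion G cl x) ↔
      ∃ prob : (c : C) → EfficientRoute G x (cl c) → ℝ, IsRouteDistribution prob ∧
        (∀ i, expNodeLoad rate prob i < G.nodeCap i) ∧
        (∀ i j, G.graph.Adj i j → expLinkLoad rate prob i j < G.linkCap i j) := by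
  rw [mem_interior_iff_mem_nhds]
  constructor
  · intro h
    -- An interior vector can be scaled by some `r > 1` inside the region; probabilities for the
    -- scaled vector leave slack for the original one, as capacities are positive.
    have hlim : Tendsto (fun r : ℝ≥0 => r • rate) (𝓝[>] 1) (𝓝 rate) := by
      have : Tendsto (fun r : ℝ≥0 => r • rate) (𝓝 1) (𝓝 ((1 : ℝ≥0) • rate)) :=
        Continuous.tendsto (by fun_prop) 1
      rw [one_smul] at this
      exact this.mono_left nhdsWithin_le_nhds
    obtain ⟨r, hr, hr1⟩ := ((hlim.eventually h).and self_mem_nhdsWithin).exists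
    have hr1 : (1 : ℝ) < r := hr1
    obtain ⟨prob, hprob, hnode, hlink⟩ := mem_stabilityRegion_iff.1 hr
    have key : ∀ {y b : ℝ}, 0 < b → r * y ≤ b → y < b := by
      intro y b hb hy
      by_contra! hby
      nlinarith
    refine ⟨prob, hprob, fun i => key (G.nodeCap_pos i) ?_, fun i j hij =>
      key (G.linkCap_pos i j hij) ?_⟩
    · rw [← expNodeLoad_smul]; exact hnode i
    · rw [← expLinkLoad_smul]; exact hlink i j hij
  · rintro ⟨prob, hprob, hnode, hlink⟩
    have h1 : ∀ᶠ r in 𝓝 rate, ∀ i, expNodeLoad r prob i < G.nodeCap i :=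
      eventually_all.2 fun i => (Continuous.tendsto (f := fun r => expNodeLoad r prob i)
        (by unfold expNodeLoad; fun_prop) rate).eventually_lt_const (hnode i)
    have h2 : ∀ᶠ r in 𝓝 rate, ∀ i j, G.graph.Adj i j → expLinkLoad r prob i j < G.linkCap i j :=
      eventually_all.2 fun i => eventually_all.2 fun j => eventually_imp_distrib_left.2 fun hij =>
        (Continuous.tendsto (f := fun r => expLinkLoad r prob i j)
          (by unfold expLinkLoad; fun_prop) rate).eventually_lt_const (hlink i j hij)
    filter_upwards [h1, h2] with r hr1 hr2
    exact mem_stabilityRegion_iff.2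
      ⟨prob, hprob, fun i => (hr1 i).le, fun i j hij => (hr2 i j hij).le⟩

end Region

end

theorem theorem1 {V K C : Type*} [Fintype V] [Fintype K] [Fintype C]
    (G : EdgeCloud V K) (cl : C → Client V K)
    (x : Placement V K) (hx : x ∈ G.placements) (rate : C → ℝ≥0) :
    -- an arrival vector is in the stability region iff the load constraints can be met
    (rate ∈ stabilityRegion G cl x ↔
      ∃ prob : (c : C) → EfficientRoute G x (cl c) → ℝ, IsRouteDistribution prob ∧
        (∀ i, expNodeLoad rate prob i ≤ G.nodeCap i) ∧
        (∀ i j, G.graph.Adj i j → expLinkLoad rate prob i j ≤ G.linkCap i j)) ∧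
    -- it is a topological interior point (in the nonnegative orthant) iff they can be met strictly
    (rate ∈ interior (stabilityRegion G cl x) ↔
      ∃ prob : (c : C) → EfficientRoute G x (cl c) → ℝ, IsRouteDistribution prob ∧
        (∀ i, expNodeLoad rate prob i < G.nodeCap i) ∧
        (∀ i j, G.graph.Adj i j → expLinkLoad rate prob i j < G.linkCap i j)) ∧
    -- the region does not depend on which arrival process with the given rates is considered
    (∀ (Ω : Type) [MeasurableSpace Ω] (P : Measure Ω) [IsProbabilityMeasure P]
      (a : ℕ → Ω → C → ℕ), IsArrivalProcess P a rate →
        (IsStabilizable G cl x P a ↔ rate ∈ stabilityRegion G cl x)) := by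
  refine ⟨mem_stabilityRegion_iff, mem_interior_stabilityRegion_iff, ?_⟩
  intro Ω _ P _ a ha
  -- Stabilizing this one process already forces the load constraints, which then cover all
  -- processes of the same rates.
  exact ⟨fun h => mem_stabilityRegion_iff.2 (ha.exists_prob h), fun h => h Ω P a ha⟩
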